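/- Let $N,T\ge 1$ and $L\ge 0$ be integers. Let $(A(k))_{k\in\mathbb Z}$ be complex $N\times T$ matrices with $A(k)=0$ for $|k|>L$. Let $\phi:\mathbb Z\to[0,\infty)$ vanish outside $\{-L,\dots,L\}$, and put $\sigma^2=\sum_\ell\phi(\ell)^2$. Let $\gamma:\mathbb Z\to\mathbb C$ be the covariance function of a stationary complex random sequence (that is, the matrix $[\gamma(k_1-k_2)]_{k_1,k_2\in\mathbb Z}$ is positive semidefinite) with $\gamma(0)=1$ and $\sum_k|\gamma(k)|<\infty$. For $f\in\mathbb R$ put $$\boldsymbol\gamma(f)=\sum_k e^{2\pi i k f}\gamma(k),\qquad \boldsymbol A(f)=\sum_k e^{2\pi i k f}A(k).$$ For $z\in\mathbb C_+=\{z:\Im z>0\}$ and integrable $\varphi,\tilde\varphi:[0,1]\to\mathbb C$ put $$\zeta(f)=\sigma^2\int_0^1\boldsymbol\gamma(u-f)\varphi(u)\,du,\qquad \tilde\zeta(f)=\sigma^2\int_0^1\boldsymbol\gamma(f-u)\tilde\varphi(u)\,du,$$ $$\boldsymbol S(f,z)=\Bigl[-z(1+\tilde\zeta(f))I_N+(1+\zeta(f))^{-1}\boldsymbol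 A(f)\boldsymbol A(f)^*\Bigr]^{-1},$$ $$\tilde{\boldsymbol S}(f,z)=\Bigl[-z(1+\zeta(f))I_T+(1+\tilde\zeta(f))^{-1}\boldsymbol A(f)^*\boldsymbol A(f)\Bigr]^{-1}.$$ Call $(\varphi,\tilde\varphi)$ admissible for $z$ if both functions are Lebesgue measurable and integrable on $[0,1]$ and $\Im\varphi(f)$, $\Im\tilde\varphi(f)$, $\Im(z\varphi(f))$, $\Im(z\tilde\varphi(f))$ are nonnegative for every $f\in[0,1]$. Then: 1. For every $z\in\mathbb C_+$, every pair admissible for $z$ and every $f\in[0,1]$, all the inverses above exist. 2. For every $z\in\mathbb C_+$ there is exactly one admissible pair $(\varphi(\cdot,z),\tilde\varphi(\cdot,z))$ that satisfies $$\varphi(f,z)=\tfrac1T\operatorname{tr}\boldsymbol S(f,z),\qquad \tilde\varphi(f,z)=\tfrac1T\operatorname{tr}\tilde{\boldsymbol S}(f,z)\qquad\text{for all } f\in[0,1].$$ 3. For every $z\in\mathbb C_+$, $\varphi(\cdot,z)$ and $\tilde\varphi(\cdot,z)$ are continuous on $[0,1]$, and $\Im\varphi(f,z)>0$ and $\Im\tilde\varphi(f,z)>0$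 for all $f\in[0,1]$. If $\sigma^2>0$, then also $\Im(z\varphi(f,z))>0$ and $\Im(z\tilde\varphi(f,z))>0$ for all $f\in[0,1]$. 4. For every $f\in[0,1]$, the functions $\frac TN\varphi(f,\cdot)$ and $\tilde\varphi(f,\cdot)$ extend to $\mathbb C\setminus[0,\infty)$ and are there the Stieltjes transforms $z\mapsto\int\frac{\nu(d\lambda)}{\lambda-z}$ of probability measures $\nu$ supported by $[0,\infty)$. -/

import Mathlib

open MeasureTheory
open scoped ComplexOrder

noncomputable section

namespace ErgodicMIMO

/-- A sequence `γ : ℤ → ℂ` is the covariance function of a (wide-sense) stationary complex random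
sequence, `E[W(k₁) conj W(k₂)] = γ(k₁ - k₂)`, exactly when the doubly infinite Toeplitz matrix
`[γ(k₁ - k₂)]` is positive semidefinite (Hermitian, with nonnegative quadratic form on finitely
supported vectors). -/
def IsCovarianceFunction (γ : ℤ → ℂ) : Prop :=
  (Matrix.of fun k₁ k₂ : ℤ => γ (k₁ - k₂)).PosSemidef

/-- `σ² = ∑_ℓ φ(ℓ)²` for an amplitude profile `φ` supported by `{-L, …, L}`. -/
def power (L : ℕ) (amp : ℤ → ℝ) : ℝ :=
  ∑ ℓ ∈ Finset.Icc (-(L : ℤ)) L, amp ℓ ^ 2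

/-- `𝛄(f) = ∑_k exp(2πi k f) γ(k)`. -/
def covFourier (γ : ℤ → ℂ) (f : ℝ) : ℂ :=
  ∑' k : ℤ, Complex.exp (2 * Complex.I * Real.pi * k * f) * γ k

/-- `𝐀(f) = ∑_k exp(2πi k f) A(k)` for a sequence of matrices supported by `{-L, …, L}`. -/
def matFourier {N T : ℕ} (L : ℕ) (A : ℤ → Matrix (Fin N) (Fin T) ℂ) (f : ℝ) :
    Matrix (Fin N) (Fin T) ℂ :=
  ∑ k ∈ Finset.Icc (-(L : ℤ)) L, Complex.exp (2 * Complex.I * Real.pi * k * f) • A k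

/-- `(g(f) ⋆ ψ)(f) = ∫₀¹ g(f - u) ψ(u) du`. -/
def conv (g : ℝ → ℂ) (ψ : unitInterval → ℂ) (f : ℝ) : ℂ :=
  ∫ u : unitInterval, g (f - u) * ψ u

/-- `(g(-f) ⋆ ψ)(f) = ∫₀¹ g(u - f) ψ(u) du`. -/
def convNeg (g : ℝ → ℂ) (ψ : unitInterval → ℂ) (f : ℝ) : ℂ :=
  ∫ u : unitInterval, g (u - f) * ψ u

/-- The scalar `1 + σ² 𝛄(-f) ⋆ φ(f)`. -/
def den (s : ℝ) (γ : ℤ → ℂ) (φ : unitInterval → ℂ) (f : ℝ) : ℂ :=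
  1 + (s : ℂ) * convNeg (covFourier γ) φ f

/-- The scalar `1 + σ² 𝛄(f) ⋆ φ̃(f)`. -/
def denTilde (s : ℝ) (γ : ℤ → ℂ) (φt : unitInterval → ℂ) (f : ℝ) : ℂ :=
  1 + (s : ℂ) * conv (covFourier γ) φt f

/-- The `N × N` matrix whose inverse is `𝐒(f,z)`. -/
def preS {N T : ℕ} (L : ℕ) (A : ℤ → Matrix (Fin N) (Fin T) ℂ) (s : ℝ) (γ : ℤ → ℂ) (z : ℂ)
    (φ φt : unitInterval → ℂ) (f : ℝ) : Matrix (Fin N) (Fin N) ℂ :=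
  (-z * denTilde s γ φt f) • (1 : Matrix (Fin N) (Fin N) ℂ)
    + (den s γ φ f)⁻¹ • (matFourier L A f * (matFourier L A f).conjTranspose)

/-- The `T × T` matrix whose inverse is `𝐒̃(f,z)`. -/
def preSTilde {N T : ℕ} (L : ℕ) (A : ℤ → Matrix (Fin N) (Fin T) ℂ) (s : ℝ) (γ : ℤ → ℂ) (z : ℂ)
    (φ φt : unitInterval → ℂ) (f : ℝ) : Matrix (Fin T) (Fin T) ℂ :=
  (-z * den s γ φ f) • (1 : Matrix (Fin T) (Fin T) ℂ)
    + (denTilde s γ φt f)⁻¹ • ((matFourier L A f).conjTranspose * matFourier L A f)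

/-- The matrix `𝐒(f,z)`. -/
def matS {N T : ℕ} (L : ℕ) (A : ℤ → Matrix (Fin N) (Fin T) ℂ) (s : ℝ) (γ : ℤ → ℂ) (z : ℂ)
    (φ φt : unitInterval → ℂ) (f : ℝ) : Matrix (Fin N) (Fin N) ℂ :=
  (preS L A s γ z φ φt f)⁻¹

/-- The matrix `𝐒̃(f,z)`. -/
def matSTilde {N T : ℕ} (L : ℕ) (A : ℤ → Matrix (Fin N) (Fin T) ℂ) (s : ℝ) (γ : ℤ → ℂ) (z : ℂ)
    (φ φt : unitInterval → ℂ) (f : ℝ) : Matrix (Fin T) (Fin T) ℂ :=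
  (preSTilde L A s γ z φ φt f)⁻¹

/-- The class of pairs in which solutions are sought: Lebesgue measurable and integrable functions
on `[0,1]` with `Im φ, Im φ̃, Im (zφ), Im (zφ̃) ≥ 0` everywhere. -/
structure IsAdmissible (z : ℂ) (φ φt : unitInterval → ℂ) : Prop where
  integrable : Integrable φ
  integrable_tilde : Integrable φt
  im_nonneg : ∀ f, 0 ≤ (φ f).im
  im_nonneg_tilde : ∀ f, 0 ≤ (φt f).im
  im_mul_nonneg : ∀ f, 0 ≤ (z * φ f).im
  im_mul_nonneg_tilde : ∀ f, 0 ≤ (z * φt f).im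

/-- `(φ, φ̃)` is an admissible solution of `φ(f) = tr 𝐒(f,z) / T`, `φ̃(f) = tr 𝐒̃(f,z) / T`
for every `f ∈ [0,1]`. -/
structure IsSolution {N T : ℕ} (L : ℕ) (A : ℤ → Matrix (Fin N) (Fin T) ℂ) (s : ℝ) (γ : ℤ → ℂ)
    (z : ℂ) (φ φt : unitInterval → ℂ) : Prop extends IsAdmissible z φ φt where
  eq : ∀ f : unitInterval, φ f = (matS L A s γ z φ φt f).trace / (T : ℂ)
  eq_tilde : ∀ f : unitInterval, φt f = (matSTilde L A s γ z φ φt f).trace / (T : ℂ)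

/-- On `ℂ \ [0,∞)`, the function `m` is the Stieltjes transform `z ↦ ∫ ν(dx) / (x - z)` of a
probability measure `ν` on `ℝ` supported by `[0,∞)`. -/
def IsStieltjesTransform (m : ℂ → ℂ) : Prop :=
  ∃ ν : Measure ℝ, IsProbabilityMeasure ν ∧ ν (Set.Iio 0) = 0 ∧
    ∀ z : ℂ, (z.im ≠ 0 ∨ z.re < 0) → m z = ∫ x : ℝ, 1 / ((x : ℂ) - z) ∂ν

end ErgodicMIMO

end

open ErgodicMIMO

noncomputable section

open Filter Topology

namespace ErgodicMIMO

/-! ### Covariance functions and their Fourier series -/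

section

/-! Choose `w` in the open first quadrant with `w² = z` and take `m = wφ`, `m̃ = wφ̃` as unknowns.
Diagonalizing the Gram matrices turns the equations into `m = T⁻¹ ∑ 1 / (l / a - a')` and its mirror
image with `a`, `a'` exchanged, where `a = w + ∫ ker · m` and `a' = w + ∫ ker' · m̃`. The kernels
are nonnegative because the spectral density of `γ` is (`covFourier_nonneg`), so the right-hand side
preserves pairs of functions with values in the upper half-plane, and `w` enters only as a
translation.

This map contracts in a hyperbolic sense. The bound `‖x - y‖ ≤ Q √(Im x · Im y)` survives positive
sums and integrals and the map `(a, a') ↦ 1 / (l / a - a')` (`HypNear.res`), while translation by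
`w` improves `Q` by a factor below one on bounded sets (`HypNear.const_add`). Every fixed point is
bounded and stays away from the real axis, so two fixed points are near with some finite `Q`, hence
with `Q` arbitrarily small, and they coincide. In the same way the iterates converge geometrically,
locally uniformly in `w`, to a holomorphic solution.

The solution must still be shown admissible, since `Im (wφ) ≥ 0` gives neither `Im φ ≥ 0` nor `Im
(zφ) ≥ 0`. As a function of `w`, the solution is a Nevanlinna function with known decay at `i∞`,
hence the Stieltjes transform of a finite measure on the line (`exists_stieltjes_measure`). By
uniqueness it is symmetric under `w ↦ -w̄`. Symmetrizing the kernel and pushing the measure forward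
by `x ↦ x²` represents `φ` as a multiple of a Stieltjes transform in `z` over `[0, ∞)`
(`exists_probability_sol`). This yields admissibility, `Im φ > 0` and the extension in `z`.
Strictness of `Im (zφ)` comes from `∫ 𝛄 = γ(0) = 1` when `σ² > 0`. -/

lemma norm_exp_fourier (k : ℤ) (f : ℝ) :
    ‖Complex.exp (2 * Complex.I * Real.pi * k * f)‖ = 1 := by
  have : (2 * Complex.I * Real.pi * k * f : ℂ) = ((2 * Real.pi * k * f : ℝ) : ℂ) * Complex.I := by
    push_cast; ring
  rw [this, Complex.norm_exp_ofReal_mul_I]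

/-- For a summable sequence the Fejér means `n⁻¹ ∑_{j,k<n} g (j - k)` converge to its sum. -/
lemma tendsto_fejer_mean {g : ℤ → ℂ} (hg : Summable g) :
    Tendsto (fun n : ℕ => (n : ℝ)⁻¹ • ∑ j ∈ Finset.range n, ∑ k ∈ Finset.range n, g (j - k))
      atTop (𝓝 (∑' k, g k)) := by
  -- Passing from `n` to `n + 1` adds one row and one column of the square, that is, a symmetric
  -- partial sum of the series. The Fejér means are therefore Cesàro means of these partial sums.
  have key : ∀ n : ℕ, ∑ j ∈ Finset.range n, ∑ k ∈ Finset.range n, g (j - k)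
      = ∑ p ∈ Finset.range n,
        (∑ i ∈ Finset.range (p + 1), g i + ∑ i ∈ Finset.range p, g (-((i : ℤ) + 1))) := by
    intro n
    induction n with
    | zero => simp
    | succ n ih =>
      have h1 : ∑ k ∈ Finset.range (n + 1), g ((n : ℤ) - k) = ∑ i ∈ Finset.range (n + 1), g i := by
        rw [← Finset.sum_range_reflect]
        refine Finset.sum_congr rfl fun j hj => ?_
        rw [Finset.mem_range] at hj
        congr 1; omega
      have h2 : ∑ k ∈ Finset.range n, g ((k : ℤ) - n)
          = ∑ j ∈ Finset.range n, g (-((j : ℤ) + 1)) := by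
        rw [← Finset.sum_range_reflect]
        refine Finset.sum_congr rfl fun j hj => ?_
        rw [Finset.mem_range] at hj
        congr 1; omega
      rw [Finset.sum_range_succ, h1]
      simp_rw [Finset.sum_range_succ (fun k : ℕ => g ((_ : ℤ) - k)) n]
      rw [Finset.sum_add_distrib, ih, h2,
        Finset.sum_range_succ (fun p => ∑ i ∈ Finset.range (p + 1), g i + _)]
      ring
  simp_rw [key]
  apply Tendsto.cesaro_smul
  have hs1 : Summable fun i : ℕ => g i := hg.comp_injective Nat.cast_injective
  have hs2 : Summable fun i : ℕ => g (-((i : ℤ) + 1)) :=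
    hg.comp_injective fun a b h => by simpa using h
  rw [tsum_of_nat_of_neg_add_one hs1 hs2]
  exact ((tendsto_add_atTop_iff_nat 1).2 hs1.hasSum.tendsto_sum_nat).add
    hs2.hasSum.tendsto_sum_nat

variable {γ : ℤ → ℂ}

lemma summable_covFourier (hs : Summable fun k => ‖γ k‖) (f : ℝ) :
    Summable fun k : ℤ => Complex.exp (2 * Complex.I * Real.pi * k * f) * γ k :=
  Summable.of_norm (by simpa [norm_exp_fourier] using hs)

/-- The spectral density of a covariance function is nonnegative. -/
lemma covFourier_nonneg (hγ : IsCovarianceFunction γ) (hs : Summable fun k => ‖γ k‖) (f : ℝ) :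
    0 ≤ covFourier γ f := by
  refine ge_of_tendsto' (tendsto_fejer_mean (summable_covFourier hs f)) fun n => ?_
  refine smul_nonneg (by positivity) ?_
  -- With the test vector `exp(-2πi j f)`, the quadratic form of the Toeplitz section is exactly the
  -- Fejér sum of the Fourier terms.
  have h := (Matrix.PosSemidef.submatrix hγ (fun i : Fin n => ((i : ℕ) : ℤ))).dotProduct_mulVec_nonneg
    (fun i : Fin n => Complex.exp (-(2 * Complex.I * Real.pi * (i : ℕ) * f)))
  convert h using 1
  simp only [dotProduct, Matrix.mulVec, Finset.mul_sum, Finset.sum_range]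
  refine Finset.sum_congr rfl fun i _ => Finset.sum_congr rfl fun j _ => ?_
  simp only [Pi.star_apply, RCLike.star_def, ← Complex.exp_conj, Matrix.submatrix_apply,
    Matrix.of_apply]
  rw [mul_comm (γ _) _, ← mul_assoc, ← Complex.exp_add]
  congr 2
  have h2 : (starRingEnd ℂ) 2 = 2 := Complex.conj_ofReal 2
  simp [h2]
  ring

lemma continuous_covFourier (hs : Summable fun k => ‖γ k‖) : Continuous (covFourier γ) := by
  refine continuous_tsum (fun k => by fun_prop) hs fun k f => ?_
  simp [norm_exp_fourier]

lemma integral_exp_fourier (k : ℤ) (hk : k ≠ 0) (f : ℝ) :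
    ∫ u : unitInterval, Complex.exp (2 * Complex.I * Real.pi * k * ((f - u : ℝ) : ℂ)) = 0 := by
  have h0 : (-(2 * Complex.I * Real.pi * k) : ℂ) ≠ 0 := by simp [Real.pi_ne_zero, hk]
  have h1 : ∀ u : ℝ, Complex.exp (2 * Complex.I * Real.pi * k * ((f - u : ℝ) : ℂ)) =
      Complex.exp (2 * Complex.I * Real.pi * k * f) *
        Complex.exp (-(2 * Complex.I * Real.pi * k) * u) := by
    intro u; rw [← Complex.exp_add]; congr 1; push_cast; ring
  have h2 : ∫ u : unitInterval, Complex.exp (2 * Complex.I * Real.pi * k * ((f - u : ℝ) : ℂ)) =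
      ∫ u in (0 : ℝ)..1, Complex.exp (2 * Complex.I * Real.pi * k * ((f - u : ℝ) : ℂ)) := by
    rw [intervalIntegral.integral_of_le zero_le_one, ← integral_Icc_eq_integral_Ioc]
    exact integral_subtype_comap (s := Set.Icc (0 : ℝ) 1) measurableSet_Icc
      fun u : ℝ => Complex.exp (2 * Complex.I * Real.pi * k * ((f - u : ℝ) : ℂ))
  rw [h2]
  simp_rw [h1]
  rw [intervalIntegral.integral_const_mul, integral_exp_mul_complex h0]
  have : Complex.exp (-(2 * Complex.I * Real.pi * k) * (1 : ℝ)) = 1 := by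
    rw [Complex.exp_eq_one_iff]; exact ⟨-k, by push_cast; ring⟩
  rw [this]; simp

/-- `∫₀¹ 𝛄(f - u) du = γ(0)`. -/
lemma integral_covFourier_sub (hs : Summable fun k => ‖γ k‖) (f : ℝ) :
    ∫ u : unitInterval, covFourier γ (f - u) = γ 0 := by
  have h := hasSum_integral_of_summable_integral_norm (μ := (volume : Measure unitInterval))
    (F := fun (k : ℤ) (u : unitInterval) =>
      Complex.exp (2 * Complex.I * Real.pi * k * ((f - u : ℝ) : ℂ)) * γ k)
    (fun k => Continuous.integrable_of_hasCompactSupport (by fun_prop)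
      (HasCompactSupport.of_compactSpace _)) (by
      simpa only [norm_mul, norm_exp_fourier, one_mul, integral_const, probReal_univ, one_smul]
        using hs)
  refine h.unique ((hasSum_ite_eq (0 : ℤ) (γ 0)).congr_fun fun k => ?_)
  rw [integral_mul_const]
  split_ifs with hk
  · simp [hk]
  · rw [integral_exp_fourier k hk, zero_mul]

end

/-! ### Traces of resolvents of Hermitian matrices -/

section

section Matrix

variable {ι : Type*} [Fintype ι] [DecidableEq ι] {B : Matrix ι ι ℂ}

/-- All matrices `α + βB` are diagonal in the eigenbasis of `B`, so invertibility and the trace of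
the inverse become scalar statements. -/
lemma smul_one_add_smul_eq_conj (hB : B.IsHermitian) (α β : ℂ) :
    α • (1 : Matrix ι ι ℂ) + β • B = (hB.eigenvectorUnitary : Matrix ι ι ℂ) *
      Matrix.diagonal (fun i => α + β * hB.eigenvalues i) *
        star (hB.eigenvectorUnitary : Matrix ι ι ℂ) := by
  have h1 : Matrix.diagonal (fun i => α + β * (hB.eigenvalues i : ℂ)) =
      α • (1 : Matrix ι ι ℂ) + β • Matrix.diagonal (RCLike.ofReal ∘ hB.eigenvalues) := by
    ext i j
    by_cases h : i = j <;> simp [h]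
  conv_lhs => rw [hB.spectral_theorem, Unitary.conjStarAlgAut_apply]
  rw [h1, mul_add, add_mul]
  simp

lemma isUnit_smul_one_add_smul (hB : B.IsHermitian) {α β : ℂ}
    (h : ∀ i, α + β * hB.eigenvalues i ≠ 0) : IsUnit (α • (1 : Matrix ι ι ℂ) + β • B) := by
  rw [smul_one_add_smul_eq_conj hB, Matrix.isUnit_iff_isUnit_det, Matrix.det_mul, Matrix.det_mul,
    mul_right_comm, ← Matrix.det_mul]
  simp [Finset.prod_ne_zero_iff, h]

lemma trace_inv_smul_one_add_smul (hB : B.IsHermitian) {α β : ℂ}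
    (h : ∀ i, α + β * hB.eigenvalues i ≠ 0) :
    (α • (1 : Matrix ι ι ℂ) + β • B)⁻¹.trace = ∑ i, 1 / (α + β * hB.eigenvalues i) := by
  have hinv : (α • (1 : Matrix ι ι ℂ) + β • B)⁻¹ = (hB.eigenvectorUnitary : Matrix ι ι ℂ) *
      Matrix.diagonal (fun i => 1 / (α + β * hB.eigenvalues i)) *
        star (hB.eigenvectorUnitary : Matrix ι ι ℂ) := by
    refine Matrix.inv_eq_right_inv ?_
    have hU : star (hB.eigenvectorUnitary : Matrix ι ι ℂ) *
      (hB.eigenvectorUnitary : Matrix ι ι ℂ) = 1 := by simp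
    have hU' : (hB.eigenvectorUnitary : Matrix ι ι ℂ) *
      star (hB.eigenvectorUnitary : Matrix ι ι ℂ) = 1 := by simp
    rw [smul_one_add_smul_eq_conj hB]
    simp only [mul_assoc]
    rw [← mul_assoc (star _) _ (Matrix.diagonal _ * _), hU, one_mul,
      ← mul_assoc (Matrix.diagonal _), Matrix.diagonal_mul_diagonal]
    simp [h, hU']
  rw [hinv, Matrix.trace_mul_comm, ← mul_assoc]
  simp [Matrix.trace_diagonal]

/-- Cramer's formula gives continuity of the trace without any continuity of individual eigenvalues.
-/
lemma continuous_trace_inv {X : Type*} [TopologicalSpace X] {M : X → Matrix ι ι ℂ}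
    (hM : Continuous M) (hu : ∀ x, IsUnit (M x)) : Continuous fun x => (M x)⁻¹.trace := by
  simp_rw [Matrix.inv_def, Ring.inverse_eq_inv]
  exact ((hM.matrix_det.inv₀ fun x => ((Matrix.isUnit_iff_isUnit_det _).1 (hu x)).ne_zero).smul
    hM.matrix_adjugate).matrix_trace

lemma eigenvalues_le_trace (hB : B.PosSemidef) (i : ι) :
    hB.isHermitian.eigenvalues i ≤ B.trace.re := by
  rw [hB.isHermitian.trace_eq_sum_eigenvalues]
  simp only [RCLike.ofReal_eq_complex_ofReal, Complex.re_sum, Complex.ofReal_re]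
  exact Finset.single_le_sum (f := hB.isHermitian.eigenvalues)
    (fun j _ => hB.eigenvalues_nonneg j) (Finset.mem_univ i)

end Matrix

lemma continuous_matFourier {N T : ℕ} (L : ℕ) (A : ℤ → Matrix (Fin N) (Fin T) ℂ) :
    Continuous (matFourier L A) := by
  unfold matFourier
  fun_prop

end

/-! ### Hyperbolic closeness and its contraction -/

section

/-- `HypNear Q x y` says `‖x - y‖ ≤ Q √(Im x · Im y)`, written so that it is visibly stable under
sums and positive integrals. -/
def HypNear (Q : ℝ) (x y : ℂ) : Prop :=
  ∀ t : ℝ, 0 < t → 2 * ‖x - y‖ ≤ Q * (t * x.im + t⁻¹ * y.im)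

lemma HypNear.sum {ι : Type*} (s : Finset ι) {Q : ℝ} {x y : ι → ℂ}
    (h : ∀ i ∈ s, HypNear Q (x i) (y i)) : HypNear Q (∑ i ∈ s, x i) (∑ i ∈ s, y i) := by
  intro t ht
  rw [← Finset.sum_sub_distrib, Complex.im_sum, Complex.im_sum, Finset.mul_sum, Finset.mul_sum,
    ← Finset.sum_add_distrib, Finset.mul_sum]
  calc 2 * ‖∑ i ∈ s, (x i - y i)‖ ≤ 2 * ∑ i ∈ s, ‖x i - y i‖ := by
        gcongr; exact norm_sum_le _ _
    _ = ∑ i ∈ s, 2 * ‖x i - y i‖ := Finset.mul_sum _ _ _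
    _ ≤ _ := Finset.sum_le_sum fun i hi => h i hi t ht

lemma HypNear.real_mul {Q : ℝ} {x y : ℂ} (h : HypNear Q x y) {c : ℝ} (hc : 0 ≤ c) :
    HypNear Q (c * x) (c * y) := by
  intro t ht
  rw [← mul_sub, norm_mul, Complex.norm_real, Real.norm_of_nonneg hc,
    Complex.im_ofReal_mul, Complex.im_ofReal_mul]
  nlinarith [mul_le_mul_of_nonneg_left (h t ht) hc]

/-- Starts the contraction argument: on a bounded set at height at least `c`, any two points are
near with one common constant, because `t + t⁻¹ ≥ 2`. -/
lemma HypNear.of_bounds {x y : ℂ} {M c : ℝ} (hc : 0 < c) (hx : c ≤ x.im) (hy : c ≤ y.im)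
    (hxM : ‖x‖ ≤ M) (hyM : ‖y‖ ≤ M) : HypNear (2 * M / c) x y := by
  intro t ht
  have hM : 0 ≤ M := (norm_nonneg _).trans hxM
  have ht2 : 2 ≤ t + t⁻¹ := by
    rw [← sub_nonneg]
    have : t + t⁻¹ - 2 = (t - 1) ^ 2 / t := by field_simp; ring
    rw [this]; positivity
  calc 2 * ‖x - y‖ ≤ 2 * (M + M) := by
        gcongr; exact (norm_sub_le _ _).trans (add_le_add hxM hyM)
    _ = 2 * M / c * (2 * c) := by field_simp; ring
    _ ≤ 2 * M / c * ((t + t⁻¹) * c) := by gcongr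
    _ ≤ 2 * M / c * (t * x.im + t⁻¹ * y.im) := by
        gcongr; rw [add_mul]; gcongr

/-- For fixed `t` the bound is linear in the two imaginary parts, so it can be integrated against a
positive weight; the form with a square root would need Cauchy–Schwarz. -/
lemma HypNear.integral {X : Type*} [MeasurableSpace X] {μ : Measure X} {Q : ℝ} {x y : X → ℂ}
    {k : X → ℝ} (hk : ∀ u, 0 ≤ k u) (h : ∀ u, HypNear Q (x u) (y u))
    (hx : Integrable (fun u => (k u : ℂ) * x u) μ) (hy : Integrable (fun u => (k u : ℂ) * y u) μ) :
    HypNear Q (∫ u, (k u : ℂ) * x u ∂μ) (∫ u, (k u : ℂ) * y u ∂μ) := by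
  intro t ht
  have hxi : Integrable (fun u => ((k u : ℂ) * x u).im) μ := hx.im
  have hyi : Integrable (fun u => ((k u : ℂ) * y u).im) μ := hy.im
  rw [← integral_sub hx hy]
  have e1 : (∫ u, (k u : ℂ) * x u ∂μ).im = ∫ u, ((k u : ℂ) * x u).im ∂μ := (integral_im hx).symm
  have e2 : (∫ u, (k u : ℂ) * y u ∂μ).im = ∫ u, ((k u : ℂ) * y u).im ∂μ := (integral_im hy).symm
  rw [e1, e2, ← integral_const_mul, ← integral_const_mul, ← integral_add
    (hxi.const_mul _) (hyi.const_mul _), ← integral_const_mul]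
  calc 2 * ‖∫ u, ((k u : ℂ) * x u - (k u : ℂ) * y u) ∂μ‖
      ≤ 2 * ∫ u, ‖(k u : ℂ) * x u - (k u : ℂ) * y u‖ ∂μ := by
        gcongr; exact norm_integral_le_integral_norm _
    _ = ∫ u, 2 * ‖(k u : ℂ) * x u - (k u : ℂ) * y u‖ ∂μ := (integral_const_mul _ _).symm
    _ ≤ _ := integral_mono ((hx.sub hy).norm.const_mul _)
        (((hxi.const_mul _).add (hyi.const_mul _)).const_mul _)
        fun u => (h u).real_mul (hk u) t ht

/-- Translating by a point of the upper half-plane is a strict contraction on bounded sets. -/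
lemma HypNear.const_add {Q v D : ℝ} {x y w : ℂ} (h : HypNear Q x y) (hQ : 0 ≤ Q) (hv : 0 < v)
    (hw : v ≤ w.im) (hx : 0 ≤ x.im) (hy : 0 ≤ y.im) (hxD : x.im ≤ D) (hyD : y.im ≤ D) :
    HypNear (D / (v + D) * Q) (w + x) (w + y) := by
  intro t ht
  have hD : 0 ≤ D := hx.trans hxD
  -- Since `s / (v + s)` increases with `s`, the largest height `D` gives the worst ratio.
  have aux : ∀ s : ℝ, 0 ≤ s → s ≤ D → s ≤ D / (v + D) * (w.im + s) := by
    intro s hs hsD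
    rw [div_mul_eq_mul_div, le_div_iff₀ (by positivity)]
    nlinarith [mul_le_mul_of_nonneg_left hw hD]
  have h1 := aux _ hx hxD
  have h2 := aux _ hy hyD
  rw [add_sub_add_left_eq_sub, Complex.add_im, Complex.add_im]
  calc 2 * ‖x - y‖ ≤ Q * (t * x.im + t⁻¹ * y.im) := h t ht
    _ ≤ Q * (t * (D / (v + D) * (w.im + x.im)) + t⁻¹ * (D / (v + D) * (w.im + y.im))) := by gcongr
    _ = _ := by ring

/-- `1 / (l / a - a')`, the trace contribution of an eigenvalue `l`. -/
def res (l : ℝ) (a a' : ℂ) : ℂ := 1 / (l / a - a')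

section res

variable {l : ℝ} {a a' : ℂ}

lemma res_den_im (l : ℝ) (a a' : ℂ) :
    ((l : ℂ) / a - a').im = -(l * a.im / Complex.normSq a + a'.im) := by
  rw [Complex.sub_im, Complex.div_im]
  simp
  ring

lemma res_den_ne_zero (hl : 0 ≤ l) (ha : 0 < a.im) (ha' : 0 < a'.im) : (l : ℂ) / a - a' ≠ 0 := by
  intro h
  have h1 := res_den_im l a a'
  have : 0 ≤ l * a.im / Complex.normSq a := by
    have := Complex.normSq_nonneg a; positivity
  rw [h, Complex.zero_im] at h1
  linarith

lemma res_im (l : ℝ) (a a' : ℂ) :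
    (res l a a').im = ‖res l a a'‖ ^ 2 * (l * a.im / ‖a‖ ^ 2 + a'.im) := by
  rw [res, one_div, Complex.inv_im, res_den_im, norm_inv, inv_pow, Complex.sq_norm, Complex.sq_norm]
  ring

lemma norm_res_le (hl : 0 ≤ l) (ha : 0 < a.im) {v : ℝ} (hv : 0 < v) (ha' : v ≤ a'.im) :
    ‖res l a a'‖ ≤ 1 / v := by
  rw [res, norm_div, norm_one]
  refine one_div_le_one_div_of_le hv (le_trans ?_ (Complex.abs_im_le_norm _))
  rw [res_den_im, abs_neg]
  refine le_trans ?_ (le_abs_self _)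
  have : 0 ≤ l * a.im / Complex.normSq a := by
    have := Complex.normSq_nonneg a; positivity
  linarith

lemma le_norm_res (hl : 0 ≤ l) (ha : 0 < a.im) {v B M : ℝ} (hv : 0 < v) (hav : v ≤ a.im)
    (ha' : v ≤ a'.im) (hlB : l ≤ B) (hM : ‖a'‖ ≤ M) : 1 / (B / v + M) ≤ ‖res l a a'‖ := by
  rw [res, norm_div, norm_one]
  refine one_div_le_one_div_of_le (norm_pos_iff.2 (res_den_ne_zero hl ha (hv.trans_le ha'))) ?_
  refine (norm_sub_le _ _).trans (add_le_add ?_ hM)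
  rw [norm_div, Complex.norm_real, Real.norm_of_nonneg hl]
  have : v ≤ ‖a‖ := hav.trans ((le_abs_self _).trans (Complex.abs_im_le_norm a))
  have hB : 0 ≤ B := hl.trans hlB
  gcongr

lemma le_res_im (hl : 0 ≤ l) (ha : 0 < a.im) {v B M : ℝ} (hv : 0 < v) (hav : v ≤ a.im)
    (ha' : v ≤ a'.im) (hlB : l ≤ B) (hM : ‖a'‖ ≤ M) : (1 / (B / v + M)) ^ 2 * v ≤ (res l a a').im := by
  have hB : 0 ≤ B := hl.trans hlB
  have hM0 : 0 ≤ M := (norm_nonneg _).trans hM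
  have h0 : 0 ≤ l * a.im / ‖a‖ ^ 2 := by positivity
  rw [res_im]
  have := le_norm_res hl ha hv hav ha' hlB hM
  gcongr
  linarith

lemma res_im_nonneg (hl : 0 ≤ l) (ha : 0 < a.im) (ha' : 0 < a'.im) : 0 ≤ (res l a a').im := by
  rw [res_im]; positivity

/-- A Schwarz–Pick property. The difference of the values is the product of the values times `l (a₁
- a₂) / (a₁ a₂) + (a₁' - a₂')`, and by `res_im` the imaginary part of each value splits into the two
corresponding terms. The terms match one by one, so no constant is lost. -/
lemma HypNear.res {R : ℝ} {a₁ a₂ a₁' a₂' : ℂ} (hl : 0 ≤ l) (h : HypNear R a₁ a₂)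
    (h' : HypNear R a₁' a₂') (h1 : 0 < a₁.im) (h2 : 0 < a₂.im) (h1' : 0 < a₁'.im)
    (h2' : 0 < a₂'.im) : HypNear R (res l a₁ a₁') (res l a₂ a₂') := by
  intro t ht
  have hne : ∀ a : ℂ, 0 < a.im → a ≠ 0 := by
    rintro a ha rfl; simp at ha
  have n1 := res_den_ne_zero hl h1 h1'
  have n2 := res_den_ne_zero hl h2 h2'
  have p1 : 0 < ‖ErgodicMIMO.res l a₁ a₁'‖ := norm_pos_iff.2 (one_div_ne_zero n1)
  have p2 : 0 < ‖ErgodicMIMO.res l a₂ a₂'‖ := norm_pos_iff.2 (one_div_ne_zero n2)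
  have q1 : 0 < ‖a₁‖ := norm_pos_iff.2 (hne _ h1)
  have q2 : 0 < ‖a₂‖ := norm_pos_iff.2 (hne _ h2)
  have hdiff : ErgodicMIMO.res l a₁ a₁' - ErgodicMIMO.res l a₂ a₂' =
      ErgodicMIMO.res l a₁ a₁' * ErgodicMIMO.res l a₂ a₂' *
        (l * (a₁ - a₂) / (a₁ * a₂) + (a₁' - a₂')) := by
    have hd : (l : ℂ) * (a₁ - a₂) / (a₁ * a₂) = l / a₂ - l / a₁ := by
      have := hne _ h1; have := hne _ h2
      field_simp
    rw [hd, ErgodicMIMO.res, ErgodicMIMO.res]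
    set d₁ := (l : ℂ) / a₁ - a₁' with hd1
    set d₂ := (l : ℂ) / a₂ - a₂' with hd2
    have : (l : ℂ) / a₂ - l / a₁ + (a₁' - a₂') = d₂ - d₁ := by rw [hd1, hd2]; ring
    rw [this]
    field_simp
  rw [hdiff, res_im, res_im, norm_mul, norm_mul]
  set r₁ := ‖ErgodicMIMO.res l a₁ a₁'‖
  set r₂ := ‖ErgodicMIMO.res l a₂ a₂'‖
  -- Each hypothesis is used at its own parameter, rescaled so that the prefactors become `r₁²` and
  -- `r₂²`, respectively `r₁² / ‖a₁‖²` and `r₂² / ‖a₂‖²`, with the common `t` and `t⁻¹`.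
  have e' := h' (t * r₁ / r₂) (by positivity)
  have e := h (t * r₁ * ‖a₂‖ / (r₂ * ‖a₁‖)) (by positivity)
  calc 2 * (r₁ * r₂ * ‖(l : ℂ) * (a₁ - a₂) / (a₁ * a₂) + (a₁' - a₂')‖)
      ≤ 2 * (r₁ * r₂ * (l * ‖a₁ - a₂‖ / (‖a₁‖ * ‖a₂‖) + ‖a₁' - a₂'‖)) := by
        gcongr
        refine (norm_add_le _ _).trans (le_of_eq ?_)
        rw [norm_div, norm_mul, norm_mul, Complex.norm_real, Real.norm_of_nonneg hl]
    _ = r₁ * r₂ * l / (‖a₁‖ * ‖a₂‖) * (2 * ‖a₁ - a₂‖) + r₁ * r₂ * (2 * ‖a₁' - a₂'‖) := by ring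
    _ ≤ r₁ * r₂ * l / (‖a₁‖ * ‖a₂‖) * (R * (t * r₁ * ‖a₂‖ / (r₂ * ‖a₁‖) * a₁.im +
          (t * r₁ * ‖a₂‖ / (r₂ * ‖a₁‖))⁻¹ * a₂.im)) +
        r₁ * r₂ * (R * (t * r₁ / r₂ * a₁'.im + (t * r₁ / r₂)⁻¹ * a₂'.im)) := by gcongr
    _ = _ := by field_simp; ring

end res

end

/-! ### Coupled resolvent equations: existence and uniqueness -/

section

/-- Data of a pair of coupled resolvent trace equations on `[0,1]`: eigenvalues `lam b f`, a weight
`c` and nonnegative continuous kernels `ker b`. -/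
structure ResolventSystem where
  n : Bool → ℕ
  n_pos : ∀ b, 0 < n b
  c : ℝ
  c_pos : 0 < c
  lam : ∀ b, unitInterval → Fin (n b) → ℝ
  lam_nonneg : ∀ b f i, 0 ≤ lam b f i
  B : ℝ
  lam_le : ∀ b f i, lam b f i ≤ B
  ker : Bool → unitInterval → unitInterval → ℝ
  ker_nonneg : ∀ b f u, 0 ≤ ker b f u
  K : ℝ
  ker_le : ∀ b f u, ker b f u ≤ K
  ker_cont : ∀ b, Continuous (Function.uncurry (ker b))
  trace_cont : ∀ (b : Bool) (a a' : unitInterval → ℂ), Continuous a → Continuous a' →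
    (∀ f, 0 < (a f).im) → (∀ f, 0 < (a' f).im) →
      Continuous fun f => ∑ i, res (lam b f i) (a f) (a' f)

namespace ResolventSystem

variable (S : ResolventSystem)

/-- `w + ∫ ker(f, u) m(u) du`. -/
def shift (w : ℂ) (m : Bool → unitInterval → ℂ) (b : Bool) (f : unitInterval) : ℂ :=
  w + ∫ u, (S.ker b f u : ℂ) * m b u

/-- The map whose fixed points solve the system. -/
def step (w : ℂ) (m : Bool → unitInterval → ℂ) (b : Bool) (f : unitInterval) : ℂ :=
  S.c * ∑ i, res (S.lam b f i) (S.shift w m b f) (S.shift w m (!b) f)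

/-- Integrable pairs with values in the closed upper half-plane. -/
structure IsState (m : Bool → unitInterval → ℂ) : Prop where
  integrable : ∀ b, Integrable (m b)
  im_nonneg : ∀ b f, 0 ≤ (m b f).im

/-! ### A priori bounds, contraction and uniqueness of the fixed point -/

lemma K_nonneg : 0 ≤ S.K := (S.ker_nonneg true 0 0).trans (S.ker_le true 0 0)

lemma B_nonneg : 0 ≤ S.B := (S.lam_nonneg true 0 ⟨0, S.n_pos true⟩).trans (S.lam_le true 0 _)

/-- The total weight, which bounds the size of the resolvent traces. -/
def mass : ℝ := S.c * (S.n true + S.n false)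

lemma mass_nonneg : 0 ≤ S.mass := by
  have := S.c_pos; unfold mass; positivity

lemma c_mul_n_le_mass (b : Bool) : S.c * S.n b ≤ S.mass := by
  have := S.c_pos
  unfold mass
  cases b <;> gcongr <;> simp

variable {S} {w : ℂ} {v W : ℝ} {m m₁ m₂ : Bool → unitInterval → ℂ}

lemma continuous_ker_left (b : Bool) (f : unitInterval) : Continuous (S.ker b f) :=
  (S.ker_cont b).comp (by fun_prop : Continuous fun u : unitInterval => (f, u))

lemma continuous_ker_right (b : Bool) (u : unitInterval) : Continuous fun f => S.ker b f u :=
  (S.ker_cont b).comp (by fun_prop : Continuous fun f : unitInterval => (f, u))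

lemma norm_ker_le (b : Bool) (f u : unitInterval) : ‖(S.ker b f u : ℂ)‖ ≤ S.K := by
  rw [Complex.norm_real, Real.norm_of_nonneg (S.ker_nonneg b f u)]
  exact S.ker_le b f u

lemma integrable_ker_mul (b : Bool) (f : unitInterval) {x : unitInterval → ℂ}
    (hx : Integrable x) : Integrable fun u => (S.ker b f u : ℂ) * x u :=
  hx.bdd_mul (Complex.continuous_ofReal.comp
    (continuous_ker_left b f)).aestronglyMeasurable (ae_of_all _ fun u => norm_ker_le b f u)

lemma IsState.integral_im_nonneg (hm : IsState m) (b : Bool) (f : unitInterval) :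
    0 ≤ (∫ u, (S.ker b f u : ℂ) * m b u).im := by
  have e : (∫ u, (S.ker b f u : ℂ) * m b u).im = ∫ u, ((S.ker b f u : ℂ) * m b u).im :=
    (integral_im (integrable_ker_mul b f (hm.integrable b))).symm
  rw [e]
  refine integral_nonneg fun u => ?_
  simp only [Complex.im_ofReal_mul]
  exact mul_nonneg (S.ker_nonneg b f u) (hm.im_nonneg b u)

lemma norm_integral_ker_le {M : ℝ} (hM : ∀ b f, ‖m b f‖ ≤ M) (b : Bool) (f : unitInterval) :
    ‖∫ u, (S.ker b f u : ℂ) * m b u‖ ≤ S.K * M := by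
  have := norm_integral_le_of_norm_le_const (μ := (volume : Measure unitInterval))
    (f := fun u => (S.ker b f u : ℂ) * m b u) (C := S.K * M) (ae_of_all _ fun u => by
      rw [norm_mul]
      exact mul_le_mul (norm_ker_le b f u) (hM b u) (norm_nonneg _) S.K_nonneg)
  simpa using this

lemma IsState.le_shift_im (hm : IsState m) (b : Bool) (f : unitInterval) :
    w.im ≤ (S.shift w m b f).im := by
  rw [shift, Complex.add_im]
  linarith [hm.integral_im_nonneg (S := S) b f]

lemma IsState.shift_im_pos (hm : IsState m) (hw : 0 < w.im) (b : Bool) (f : unitInterval) :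
    0 < (S.shift w m b f).im := hw.trans_le (hm.le_shift_im b f)

lemma norm_shift_le {M : ℝ} (hM : ∀ b f, ‖m b f‖ ≤ M) (b : Bool) (f : unitInterval) :
    ‖S.shift w m b f‖ ≤ ‖w‖ + S.K * M :=
  (norm_add_le _ _).trans (add_le_add le_rfl (norm_integral_ker_le hM b f))

/-- The kernel supplies the continuity and `m` need only be integrable. This is why every solution
is automatically continuous. -/
lemma IsState.continuous_shift (hm : IsState m) (w : ℂ) (b : Bool) :
    Continuous (S.shift w m b) := by
  refine continuous_const.add (continuous_of_dominated (bound := fun u => S.K * ‖m b u‖) ?_ ?_ ?_ ?_)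
  · exact fun f => (integrable_ker_mul b f (hm.integrable b)).aestronglyMeasurable
  · refine fun f => ae_of_all _ fun u => ?_
    rw [norm_mul]
    exact mul_le_mul_of_nonneg_right (norm_ker_le b f u) (norm_nonneg _)
  · exact (hm.integrable b).norm.const_mul _
  · exact ae_of_all _ fun u =>
      (Complex.continuous_ofReal.comp (continuous_ker_right b u)).mul continuous_const

lemma IsState.continuous_step (hm : IsState m) (hw : 0 < w.im) (b : Bool) :
    Continuous (S.step w m b) :=
  continuous_const.mul (S.trace_cont b _ _ (hm.continuous_shift w b) (hm.continuous_shift w (!b))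
    (hm.shift_im_pos hw b) (hm.shift_im_pos hw (!b)))

lemma IsState.norm_step_le (hm : IsState m) (hv : 0 < v) (hw : v ≤ w.im) (b : Bool)
    (f : unitInterval) : ‖S.step w m b f‖ ≤ S.mass / v := by
  have hc := S.c_pos
  rw [step, norm_mul, Complex.norm_real, Real.norm_of_nonneg hc.le]
  calc S.c * ‖∑ i, res (S.lam b f i) (S.shift w m b f) (S.shift w m (!b) f)‖
      ≤ S.c * ∑ _i : Fin (S.n b), 1 / v := by
        gcongr
        exact norm_sum_le_of_le _ fun i _ => norm_res_le (S.lam_nonneg b f i)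
          (hm.shift_im_pos (hv.trans_le hw) b f) hv (hw.trans (hm.le_shift_im _ f))
    _ = S.c * S.n b / v := by simp; ring
    _ ≤ S.mass / v := by gcongr; exact S.c_mul_n_le_mass b

/-- Keeps images of bounded states at a definite height above the real axis, as `HypNear.of_bounds`
requires. One summand suffices, since all have positive imaginary part. -/
lemma IsState.le_step_im (hm : IsState m) (hv : 0 < v) (hw : v ≤ w.im) (hW : ‖w‖ ≤ W) {M : ℝ}
    (hM : ∀ b f, ‖m b f‖ ≤ M) (b : Bool) (f : unitInterval) :
    S.c * ((1 / (S.B / v + (W + S.K * M))) ^ 2 * v) ≤ (S.step w m b f).im := by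
  have hc := S.c_pos
  rw [step, Complex.im_ofReal_mul, Complex.im_sum]
  gcongr
  have h : ∀ i ∈ Finset.univ, (1 / (S.B / v + (W + S.K * M))) ^ 2 * v ≤
      (res (S.lam b f i) (S.shift w m b f) (S.shift w m (!b) f)).im := fun i _ =>
    le_res_im (S.lam_nonneg b f i) (hm.shift_im_pos (hv.trans_le hw) b f) hv
      (hw.trans (hm.le_shift_im _ f)) (hw.trans (hm.le_shift_im _ f)) (S.lam_le b f i)
      ((norm_shift_le hM (!b) f).trans (by gcongr))
  refine (h ⟨0, S.n_pos b⟩ (Finset.mem_univ _)).trans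
    (Finset.single_le_sum (f := fun i => (res (S.lam b f i) (S.shift w m b f)
      (S.shift w m (!b) f)).im) (fun i hi => le_trans (by positivity) (h i hi)) (Finset.mem_univ _))

lemma IsState.step (hm : IsState m) (hw : 0 < w.im) : IsState (S.step w m) where
  integrable b := (hm.continuous_step hw b).integrable_of_hasCompactSupport
    (HasCompactSupport.of_compactSpace _)
  im_nonneg b f := by
    rw [ResolventSystem.step, Complex.im_ofReal_mul, Complex.im_sum]
    exact mul_nonneg S.c_pos.le (Finset.sum_nonneg fun i _ =>
      res_im_nonneg (S.lam_nonneg b f i) (hm.shift_im_pos hw b f) (hm.shift_im_pos hw _ f))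

/-- Kernel integration and `res` do not increase the constant; adding `w` shrinks it. The integrals
have imaginary part at most `K M`, which fixes the contraction factor. -/
lemma IsState.hypNear_step (h₁ : IsState m₁) (h₂ : IsState m₂) (hv : 0 < v) (hw : v ≤ w.im)
    {M Q : ℝ} (hQ : 0 ≤ Q) (hM₁ : ∀ b f, ‖m₁ b f‖ ≤ M) (hM₂ : ∀ b f, ‖m₂ b f‖ ≤ M)
    (h : ∀ b f, HypNear Q (m₁ b f) (m₂ b f)) (b : Bool) (f : unitInterval) :
    HypNear (S.K * M / (v + S.K * M) * Q) (S.step w m₁ b f) (S.step w m₂ b f) := by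
  have hw0 := hv.trans_le hw
  have hs : ∀ b, HypNear (S.K * M / (v + S.K * M) * Q) (S.shift w m₁ b f) (S.shift w m₂ b f) := by
    intro b
    exact (HypNear.integral (S.ker_nonneg b f) (h b) (integrable_ker_mul b f (h₁.integrable b))
      (integrable_ker_mul b f (h₂.integrable b))).const_add hQ hv hw
      (h₁.integral_im_nonneg b f) (h₂.integral_im_nonneg b f)
      ((le_abs_self _).trans ((Complex.abs_im_le_norm _).trans (norm_integral_ker_le hM₁ b f)))
      ((le_abs_self _).trans ((Complex.abs_im_le_norm _).trans (norm_integral_ker_le hM₂ b f)))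
  exact (HypNear.sum _ fun i _ => (hs b).res (S.lam_nonneg b f i) (hs (!b))
    (h₁.shift_im_pos hw0 b f) (h₂.shift_im_pos hw0 b f) (h₁.shift_im_pos hw0 _ f)
    (h₂.shift_im_pos hw0 _ f)).real_mul S.c_pos.le

lemma contraction_lt_one (hv : 0 < v) {M : ℝ} (hM : 0 ≤ M) :
    0 ≤ S.K * M / (v + S.K * M) ∧ S.K * M / (v + S.K * M) < 1 := by
  have := mul_nonneg S.K_nonneg hM
  exact ⟨by positivity, by rw [div_lt_one (by positivity)]; linarith⟩

/-- A fixed point is its own image, so the bounds for images of the step map hold for it without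
further assumptions. Two fixed points are then near with some constant, and applying the step map
repeatedly drives this constant to zero. -/
theorem IsState.eq_of_step_eq (h₁ : IsState m₁) (h₂ : IsState m₂) (hw : 0 < w.im)
    (e₁ : S.step w m₁ = m₁) (e₂ : S.step w m₂ = m₂) : m₁ = m₂ := by
  set M := S.mass / w.im
  have hM0 : 0 ≤ M := div_nonneg S.mass_nonneg hw.le
  have hM₁ : ∀ b f, ‖m₁ b f‖ ≤ M := fun b f => by
    rw [← e₁]; exact h₁.norm_step_le hw le_rfl b f
  have hM₂ : ∀ b f, ‖m₂ b f‖ ≤ M := fun b f => by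
    rw [← e₂]; exact h₂.norm_step_le hw le_rfl b f
  set c₀ := S.c * ((1 / (S.B / w.im + (‖w‖ + S.K * M))) ^ 2 * w.im)
  have hwn : 0 < ‖w‖ := hw.trans_le ((le_abs_self _).trans (Complex.abs_im_le_norm _))
  have hc₀ : 0 < c₀ := by
    have := S.c_pos; have := S.K_nonneg; have := S.B_nonneg
    positivity
  have hQ : 0 ≤ 2 * M / c₀ := by positivity
  obtain ⟨ht0, ht1⟩ := contraction_lt_one (S := S) hw hM0
  set θ := S.K * M / (w.im + S.K * M)
  have key : ∀ k : ℕ, ∀ b f, HypNear (θ ^ k * (2 * M / c₀)) (m₁ b f) (m₂ b f) := by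
    intro k
    induction k with
    | zero =>
      intro b f
      rw [pow_zero, one_mul]
      refine HypNear.of_bounds hc₀ ?_ ?_ (hM₁ b f) (hM₂ b f)
      · rw [← e₁]; exact h₁.le_step_im hw le_rfl le_rfl hM₁ b f
      · rw [← e₂]; exact h₂.le_step_im hw le_rfl le_rfl hM₂ b f
    | succ k ih =>
      intro b f
      rw [← e₁, ← e₂, pow_succ', mul_assoc]
      exact h₁.hypNear_step h₂ hw le_rfl (by positivity) hM₁ hM₂ ih b f
  funext b f
  have hlim : Tendsto (fun k : ℕ => θ ^ k * (2 * M / c₀) *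
      (1 * (m₁ b f).im + 1⁻¹ * (m₂ b f).im)) atTop (𝓝 0) := by
    simpa using ((tendsto_pow_atTop_nhds_zero_of_lt_one ht0 ht1).mul_const _).mul_const
      (1 * (m₁ b f).im + 1⁻¹ * (m₂ b f).im)
  have := ge_of_tendsto' hlim fun k => key k b f 1 one_pos
  have h0 : ‖m₁ b f - m₂ b f‖ = 0 := by linarith [norm_nonneg (m₁ b f - m₂ b f)]
  exact sub_eq_zero.1 (norm_eq_zero.1 h0)

/-! ### Existence by iteration -/

variable (S) in
/-- The iterates of `step`, started from the constant `i`. -/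
def iter (w : ℂ) : ℕ → Bool → unitInterval → ℂ
  | 0 => fun _ _ => Complex.I
  | k + 1 => S.step w (iter w k)

variable (S) in
/-- The upper bound of the iterates on `v ≤ Im w`. -/
def upper (v : ℝ) : ℝ := max 1 (S.mass / v)

variable (S) in
/-- The lower bound of the imaginary parts of the iterates on `v ≤ Im w`, `‖w‖ ≤ W`. -/
def lower (v W : ℝ) : ℝ :=
  min 1 (S.c * ((1 / (S.B / v + (W + S.K * S.upper v))) ^ 2 * v))

lemma upper_pos (v : ℝ) : 0 < S.upper v := zero_lt_one.trans_le (le_max_left _ _)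

lemma lower_pos (hv : 0 < v) (hW : 0 < W) : 0 < S.lower v W := by
  have := S.c_pos; have := S.K_nonneg; have := S.B_nonneg; have := S.upper_pos v
  exact lt_min one_pos (by positivity)

lemma isState_iter (hw : 0 < w.im) (k : ℕ) : IsState (S.iter w k) := by
  induction k with
  | zero => exact ⟨fun _ => integrable_const _, fun _ _ => by simp [iter]⟩
  | succ k ih => exact ih.step hw

lemma continuous_iter (hw : 0 < w.im) (k : ℕ) (b : Bool) : Continuous (S.iter w k b) := by
  cases k with
  | zero => exact continuous_const
  | succ k => exact (isState_iter hw k).continuous_step hw b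

/-- The starting value `i` has norm one, which explains the maximum with `1` in `upper`; all later
iterates obey the bound for images. -/
lemma norm_iter_le (hv : 0 < v) (hw : v ≤ w.im) (k : ℕ) (b : Bool) (f : unitInterval) :
    ‖S.iter w k b f‖ ≤ S.upper v := by
  cases k with
  | zero => simp [iter, upper]
  | succ k =>
    exact ((isState_iter (hv.trans_le hw) k).norm_step_le hv hw b f).trans (le_max_right _ _)

lemma lower_le_iter_im (hv : 0 < v) (hw : v ≤ w.im) (hW : ‖w‖ ≤ W) (k : ℕ) (b : Bool)
    (f : unitInterval) : S.lower v W ≤ (S.iter w k b f).im := by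
  cases k with
  | zero => simp [iter, lower]
  | succ k =>
    exact (min_le_right _ _).trans ((isState_iter (hv.trans_le hw) k).le_step_im hv hw hW
      (norm_iter_le hv hw k) b f)

variable (S) in
/-- The contraction factor on `v ≤ Im w`. -/
def factor (v : ℝ) : ℝ := S.K * S.upper v / (v + S.K * S.upper v)

variable (S) in
/-- The constant in front of the geometric convergence rate. -/
def rate (v W : ℝ) : ℝ := 2 * S.upper v / S.lower v W * S.upper v

/-- Hyperbolic nearness of consecutive iterates decays like a power of the contraction factor, and
bounded heights turn it into Euclidean distance. The constants depend on `w` only through `v` and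
`W`, which later gives locally uniform convergence. -/
lemma dist_iter_succ_le (hv : 0 < v) (hw : v ≤ w.im) (hW : ‖w‖ ≤ W) (k : ℕ) (b : Bool)
    (f : unitInterval) :
    dist (S.iter w k b f) (S.iter w (k + 1) b f) ≤ S.rate v W * S.factor v ^ k := by
  have hw0 := hv.trans_le hw
  have hW0 : 0 < W := (hw0.trans_le ((le_abs_self _).trans (Complex.abs_im_le_norm _))).trans_le hW
  have hl := S.lower_pos hv hW0
  have hu := S.upper_pos v
  obtain ⟨ht0, -⟩ := contraction_lt_one (S := S) hv hu.le
  change 0 ≤ S.factor v at ht0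
  have key : ∀ k b f, HypNear (S.factor v ^ k * (2 * S.upper v / S.lower v W))
      (S.iter w k b f) (S.iter w (k + 1) b f) := by
    intro k
    induction k with
    | zero =>
      intro b f
      rw [pow_zero, one_mul]
      exact HypNear.of_bounds hl (lower_le_iter_im hv hw hW _ b f)
        (lower_le_iter_im hv hw hW _ b f) (norm_iter_le hv hw _ b f) (norm_iter_le hv hw _ b f)
    | succ k ih =>
      intro b f
      rw [pow_succ', mul_assoc]
      exact (isState_iter hw0 k).hypNear_step (isState_iter hw0 (k + 1)) hv hw (by positivity)
        (norm_iter_le hv hw _) (norm_iter_le hv hw _) ih b f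
  have h1 := key k b f 1 one_pos
  have h2 : ∀ j, (S.iter w j b f).im ≤ S.upper v := fun j =>
    (le_abs_self _).trans ((Complex.abs_im_le_norm _).trans (norm_iter_le hv hw j b f))
  rw [dist_eq_norm]
  have h3 : S.factor v ^ k * (2 * S.upper v / S.lower v W) *
      (1 * (S.iter w k b f).im + 1⁻¹ * (S.iter w (k + 1) b f).im) ≤
      S.factor v ^ k * (2 * S.upper v / S.lower v W) * (S.upper v + S.upper v) := by
    have := h2 k; have := h2 (k + 1)
    gcongr <;> linarith
  rw [rate]
  linarith

variable (S) in
/-- The solution of the system at `w`. -/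
def sol (w : ℂ) (b : Bool) (f : unitInterval) : ℂ := limUnder atTop fun k => S.iter w k b f

lemma factor_lt_one (hv : 0 < v) : S.factor v < 1 :=
  (contraction_lt_one (S := S) hv (S.upper_pos v).le).2

lemma tendsto_iter (hw : 0 < w.im) (b : Bool) (f : unitInterval) :
    Tendsto (fun k => S.iter w k b f) atTop (𝓝 (S.sol w b f)) :=
  (cauchySeq_of_le_geometric _ _ (factor_lt_one hw) fun k =>
    dist_iter_succ_le hw le_rfl le_rfl k b f).tendsto_limUnder

lemma dist_iter_sol_le (hv : 0 < v) (hw : v ≤ w.im) (hW : ‖w‖ ≤ W) (k : ℕ) (b : Bool)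
    (f : unitInterval) :
    dist (S.iter w k b f) (S.sol w b f) ≤ S.rate v W * S.factor v ^ k / (1 - S.factor v) :=
  dist_le_of_le_geometric_of_tendsto _ _ (factor_lt_one hv)
    (fun k => dist_iter_succ_le hv hw hW k b f) (tendsto_iter (hv.trans_le hw) b f) k

lemma norm_sol_le_upper (hw : 0 < w.im) (b : Bool) (f : unitInterval) :
    ‖S.sol w b f‖ ≤ S.upper w.im :=
  le_of_tendsto' (tendsto_iter hw b f).norm fun k => norm_iter_le hw le_rfl k b f

lemma sol_im_pos (hw : 0 < w.im) (b : Bool) (f : unitInterval) : 0 < (S.sol w b f).im := by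
  have hwn : 0 < ‖w‖ := hw.trans_le ((le_abs_self _).trans (Complex.abs_im_le_norm _))
  exact (S.lower_pos hw hwn).trans_le (ge_of_tendsto'
    ((Complex.continuous_im.tendsto _).comp (tendsto_iter hw b f)) fun k =>
      lower_le_iter_im hw le_rfl le_rfl k b f)

lemma isState_sol (hw : 0 < w.im) : IsState (S.sol w) where
  integrable b := by
    refine Integrable.of_bound (aestronglyMeasurable_of_tendsto_ae atTop (fun k =>
      (continuous_iter (S := S) hw k b).aestronglyMeasurable)
        (ae_of_all _ fun f => tendsto_iter hw b f)) (S.upper w.im)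
      (ae_of_all _ fun f => norm_sol_le_upper hw b f)
  im_nonneg b f := (sol_im_pos hw b f).le

theorem step_sol (hw : 0 < w.im) : S.step w (S.sol w) = S.sol w := by
  funext b f
  refine tendsto_nhds_unique ?_ ((tendsto_add_atTop_iff_nat 1).2 (tendsto_iter hw b f))
  have hshift : ∀ b, Tendsto (fun k => S.shift w (S.iter w k) b f) atTop
      (𝓝 (S.shift w (S.sol w) b f)) := by
    intro b
    refine tendsto_const_nhds.add (tendsto_integral_of_dominated_convergence
      (fun _ => S.K * S.upper w.im) (fun k => (integrable_ker_mul b f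
        ((isState_iter hw k).integrable b)).aestronglyMeasurable) (integrable_const _)
      (fun k => ae_of_all _ fun u => ?_) (ae_of_all _ fun u => ?_))
    · rw [norm_mul]
      exact mul_le_mul (norm_ker_le b f u) (norm_iter_le hw le_rfl k b u) (norm_nonneg _) S.K_nonneg
    · exact (tendsto_iter hw b u).const_mul _
  refine Tendsto.const_mul _ (tendsto_finsetSum _ fun i _ => ?_)
  have ha := (isState_sol (S := S) hw).shift_im_pos (S := S) hw b f
  have ha' := (isState_sol (S := S) hw).shift_im_pos (S := S) hw (!b) f
  have hne : S.shift w (S.sol w) b f ≠ 0 := fun h => by rw [h] at ha; simp at ha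
  exact tendsto_const_nhds.div ((tendsto_const_nhds.div (hshift b) hne).sub (hshift (!b)))
    (res_den_ne_zero (S.lam_nonneg b f i) ha ha')

lemma norm_sol_le (hw : 0 < w.im) (b : Bool) (f : unitInterval) :
    ‖S.sol w b f‖ ≤ S.mass / w.im := by
  rw [← step_sol hw]
  exact (isState_sol hw).norm_step_le hw le_rfl b f

/-- The symmetry of the solution under reflection in the imaginary axis. -/
lemma sol_neg_conj (hw : 0 < w.im) (b : Bool) (f : unitInterval) :
    S.sol (-(starRingEnd ℂ) w) b f = -(starRingEnd ℂ) (S.sol w b f) := by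
  have hw' : 0 < (-(starRingEnd ℂ) w).im := by simpa using hw
  set m : Bool → unitInterval → ℂ := fun b f => -(starRingEnd ℂ) (S.sol w b f)
  have hs := isState_sol (S := S) hw
  have hm : IsState m := ⟨fun b => (Complex.conjCLE.integrable_comp_iff.2 (hs.integrable b)).neg,
    fun b f => by simpa [m] using hs.im_nonneg b f⟩
  have hshift : ∀ b f, S.shift (-(starRingEnd ℂ) w) m b f =
      -(starRingEnd ℂ) (S.shift w (S.sol w) b f) := by
    intro b f
    simp only [shift, m, mul_neg, integral_neg, map_add, neg_add, ← integral_conj, map_mul,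
      Complex.conj_ofReal]
  -- The reflected pair is a fixed point at `-w̄`, because kernels, weights and eigenvalues are
  -- real. Uniqueness then identifies it with the solution there.
  have hstep : S.step (-(starRingEnd ℂ) w) m = m := by
    funext b f
    simp only [m]
    rw [← step_sol hw, step, step, map_mul, map_sum, Complex.conj_ofReal, ← mul_neg,
      ← Finset.sum_neg_distrib]
    congr 1
    refine Finset.sum_congr rfl fun i _ => ?_
    rw [step_sol hw, hshift, hshift, res, res, map_div₀, map_sub, map_div₀, map_one,
      Complex.conj_ofReal, ← div_neg]
    congr 1
    ring
  exact congr_fun (congr_fun ((isState_sol hw').eq_of_step_eq hm hw' (step_sol hw') hstep) b) f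

end ResolventSystem

end

/-! ### Holomorphic dependence and behaviour at infinity -/

section

/-- Integrals of locally bounded holomorphic families are holomorphic. -/
lemma differentiableOn_integral_of_bounded {X : Type*} [MeasurableSpace X] {μ : Measure X}
    [IsFiniteMeasure μ] {U : Set ℂ} (hU : IsOpen U) {F : ℂ → X → ℂ}
    (hmeas : ∀ w ∈ U, AEStronglyMeasurable (F w) μ)
    (hdiff : ∀ x, DifferentiableOn ℂ (fun w => F w x) U)
    (hbdd : ∀ w ∈ U, ∃ r > 0, ∃ C, Metric.ball w r ⊆ U ∧ ∀ y ∈ Metric.ball w r, ∀ x, ‖F y x‖ ≤ C) :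
    DifferentiableOn ℂ (fun w => ∫ x, F w x ∂μ) U := by
  intro w hw
  obtain ⟨r, hr, C, hrU, hC⟩ := hbdd w hw
  have hda : ∀ x, ∀ y ∈ U, DifferentiableAt ℂ (fun w => F w x) y := fun x y hy =>
    (hdiff x).differentiableAt (hU.mem_nhds hy)
  -- Since `r / 2 + r / 3 < r`, Cauchy's estimate on circles of radius `r / 3` bounds the
  -- derivatives uniformly on the half-radius ball.
  have hball : ∀ y ∈ Metric.ball w (r / 2), Metric.closedBall y (r / 3) ⊆ Metric.ball w r := by
    intro y hy z hz
    rw [Metric.mem_ball] at hy ⊢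
    rw [Metric.mem_closedBall] at hz
    linarith [dist_triangle z y w]
  refine (hasDerivAt_integral_of_dominated_loc_of_deriv_le (F' := fun y x => deriv (fun w => F w x) y)
    (s := Metric.ball w (r / 2)) (bound := fun _ => C / (r / 3))
    (Metric.ball_mem_nhds w (by positivity)) ?_ ?_ ?_ ?_ (integrable_const _)
    ?_).2.differentiableAt.differentiableWithinAt
  · filter_upwards [hU.mem_nhds hw] with y hy using hmeas y hy
  · exact Integrable.of_bound (hmeas w hw) C
      (ae_of_all _ fun x => hC w (Metric.mem_ball_self hr) x)
  -- The derivative is measurable in `x` as the limit of difference quotients along this sequence.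
  · have hseq : Tendsto (fun k : ℕ => w + ((r / 2 / ((k : ℝ) + 1) : ℝ) : ℂ)) atTop (𝓝[≠] w) := by
      rw [tendsto_nhdsWithin_iff]
      constructor
      · have h1 : Tendsto (fun k : ℕ => (r / 2 / ((k : ℝ) + 1) : ℝ)) atTop (𝓝 0) := by
          simpa using (tendsto_one_div_add_atTop_nhds_zero_nat (𝕜 := ℝ)).const_mul (r / 2) |>.congr
            fun k => by ring
        simpa using (tendsto_const_nhds (x := w)).add
          ((Complex.continuous_ofReal.tendsto 0).comp h1)
      · refine Eventually.of_forall fun k => ?_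
        have hk : (k : ℂ) + 1 ≠ 0 := by exact_mod_cast k.succ_ne_zero
        simpa using ⟨hr.ne', hk⟩
    refine aestronglyMeasurable_of_tendsto_ae (f := fun (k : ℕ) x =>
      slope (fun y => F y x) w (w + ((r / 2 / ((k : ℝ) + 1) : ℝ) : ℂ))) atTop (fun k => ?_)
      (ae_of_all _ fun x => ((hda x w hw).hasDerivAt.tendsto_slope).comp hseq)
    have hk : w + ((r / 2 / ((k : ℝ) + 1) : ℝ) : ℂ) ∈ Metric.ball w r := ?_
    · exact ((hmeas _ (hrU hk)).sub (hmeas w hw)).const_smul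
        (w + ((r / 2 / ((k : ℝ) + 1) : ℝ) : ℂ) - w)⁻¹
    rw [Metric.mem_ball, dist_eq_norm, add_sub_cancel_left, Complex.norm_real,
      Real.norm_of_nonneg (by positivity), div_lt_iff₀ (by positivity)]
    nlinarith [(Nat.cast_nonneg k : (0 : ℝ) ≤ k)]
  · refine ae_of_all _ fun x y hy => ?_
    refine Complex.norm_deriv_le_of_forall_mem_sphere_norm_le (by positivity) ?_ fun z hz =>
      hC z (hball y hy (Metric.sphere_subset_closedBall hz)) x
    refine DifferentiableOn.diffContOnCl fun z hz => ?_
    refine (hda x z (hrU (hball y hy ?_))).differentiableWithinAt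
    rwa [closure_ball _ (by positivity)] at hz
  · refine ae_of_all _ fun x y hy => (hda x y (hrU ?_)).hasDerivAt
    exact hball y hy (Metric.mem_closedBall_self (by positivity))

namespace ResolventSystem

variable {S : ResolventSystem}

lemma isOpen_upper : IsOpen {w : ℂ | 0 < w.im} := isOpen_lt continuous_const Complex.continuous_im

lemma differentiableOn_iter (k : ℕ) (b : Bool) (f : unitInterval) :
    DifferentiableOn ℂ (fun w => S.iter w k b f) {w | 0 < w.im} := by
  induction k generalizing b f with
  | zero => exact differentiableOn_const _
  | succ k ih =>
    have hshift : ∀ b, DifferentiableOn ℂ (fun w => S.shift w (S.iter w k) b f) {w | 0 < w.im} := by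
      intro b
      refine differentiableOn_id.add (differentiableOn_integral_of_bounded isOpen_upper
        (fun w hw => (integrable_ker_mul b f
          ((isState_iter hw k).integrable b)).aestronglyMeasurable)
        (fun u => (ih b u).const_mul _) fun w hw => ?_)
      rw [Set.mem_ofPred_eq] at hw
      -- Half the height is kept throughout the ball, so one value of `upper` bounds the integrand
      -- there.
      have hr : ∀ y ∈ Metric.ball w (w.im / 2), w.im / 2 ≤ y.im := by
        intro y hy
        rw [Metric.mem_ball, dist_eq_norm] at hy
        have := (Complex.abs_im_le_norm (y - w)).trans hy.le
        rw [abs_le, Complex.sub_im] at this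
        linarith
      refine ⟨w.im / 2, by positivity, S.K * S.upper (w.im / 2), fun y hy => ?_, fun y hy u => ?_⟩
      · exact (half_pos hw).trans_le (hr y hy)
      · rw [norm_mul]
        exact mul_le_mul (norm_ker_le b f u) (norm_iter_le (half_pos hw) (hr y hy) k b u)
          (norm_nonneg _) S.K_nonneg
    refine DifferentiableOn.const_mul (DifferentiableOn.fun_sum fun i _ => ?_) _
    have ha : ∀ w ∈ {w : ℂ | 0 < w.im}, ∀ b, 0 < (S.shift w (S.iter w k) b f).im := fun w hw b =>
      (isState_iter hw k).shift_im_pos hw b f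
    have hne : ∀ w ∈ {w : ℂ | 0 < w.im}, S.shift w (S.iter w k) b f ≠ 0 := fun w hw h => by
      have := ha w hw b
      rw [h] at this; simp at this
    exact (differentiableOn_const _).div (((differentiableOn_const _).div (hshift b) hne).sub
      (hshift (!b))) fun w hw => res_den_ne_zero (S.lam_nonneg b f i) (ha w hw b) (ha w hw (!b))

/-- A locally uniform limit of holomorphic iterates is holomorphic. The convergence rate is uniform
where the height exceeds half that of `w` and the norm is below `‖w‖ + 1`. -/
theorem differentiableOn_sol (b : Bool) (f : unitInterval) :
    DifferentiableOn ℂ (fun w => S.sol w b f) {w | 0 < w.im} := by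
  refine TendstoLocallyUniformlyOn.differentiableOn (φ := atTop)
    (F := fun k w => S.iter w k b f) ?_
    (Eventually.of_forall fun k => differentiableOn_iter k b f) isOpen_upper
  rw [Metric.tendstoLocallyUniformlyOn_iff]
  intro ε hε w hw
  rw [Set.mem_ofPred_eq] at hw
  have hv := half_pos hw
  refine ⟨{y | w.im / 2 < y.im ∧ ‖y‖ < ‖w‖ + 1}, mem_nhdsWithin_of_mem_nhds
    (IsOpen.mem_nhds ((isOpen_lt continuous_const Complex.continuous_im).inter
      (isOpen_lt continuous_norm continuous_const)) ⟨by linarith, by linarith⟩), ?_⟩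
  have h0 : 0 ≤ S.factor (w.im / 2) := (contraction_lt_one (S := S) hv (S.upper_pos _).le).1
  have hlim : Tendsto (fun k => S.rate (w.im / 2) (‖w‖ + 1) * S.factor (w.im / 2) ^ k /
      (1 - S.factor (w.im / 2))) atTop (𝓝 0) := by
    simpa using ((tendsto_pow_atTop_nhds_zero_of_lt_one h0 (factor_lt_one hv)).const_mul
        (S.rate (w.im / 2) (‖w‖ + 1))).div_const (1 - S.factor (w.im / 2))
  filter_upwards [hlim.eventually_lt_const hε] with k hk y hy
  rw [dist_comm]
  exact (dist_iter_sol_le hv hy.1.le hy.2.le k b f).trans_lt hk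

/-- The behaviour of the solution at `i∞`. -/
theorem tendsto_mul_sol (b : Bool) (f : unitInterval) :
    Tendsto (fun y : ℝ => (y * Complex.I) * S.sol (y * Complex.I) b f) atTop
      (𝓝 (-(S.c * S.n b : ℝ) : ℂ)) := by
  have him : ∀ y : ℝ, (y * Complex.I : ℂ).im = y := by simp
  have hne : ∀ᶠ y : ℝ in atTop, (y * Complex.I : ℂ) ≠ 0 := by
    filter_upwards [eventually_gt_atTop 0] with y hy
    simp [hy.ne']
  have hinv : Tendsto (fun y : ℝ => ‖(y * Complex.I : ℂ)‖⁻¹) atTop (𝓝 0) := by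
    refine tendsto_inv_atTop_zero.comp (tendsto_atTop_mono (fun y => ?_) tendsto_id)
    simp [le_abs_self]
  have hsol : ∀ᶠ y : ℝ in atTop, ∀ b f, ‖S.sol (y * Complex.I) b f‖ ≤ S.mass := by
    filter_upwards [eventually_ge_atTop 1] with y hy b f
    have hy0 : 0 < (y * Complex.I : ℂ).im := by rw [him]; linarith
    refine (norm_sol_le hy0 b f).trans (div_le_self S.mass_nonneg (by rwa [him]))
  have hquot : ∀ b, Tendsto (fun y : ℝ => (∫ u, (S.ker b f u : ℂ) * S.sol (y * Complex.I) b u) /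
      (y * Complex.I)) atTop (𝓝 0) := by
    intro b
    refine squeeze_zero_norm' (a := fun y : ℝ => S.K * S.mass * ‖(y * Complex.I : ℂ)‖⁻¹) ?_
      (by simpa using hinv.const_mul (S.K * S.mass))
    filter_upwards [hsol] with y hy
    rw [norm_div, div_eq_mul_inv]
    exact mul_le_mul_of_nonneg_right (norm_integral_ker_le hy b f) (by positivity)
  have hshift : ∀ b, Tendsto (fun y : ℝ => S.shift (y * Complex.I) (S.sol (y * Complex.I)) b f /
      (y * Complex.I)) atTop (𝓝 1) := by
    intro b
    have h := (tendsto_const_nhds (x := (1 : ℂ))).add (hquot b)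
    rw [add_zero] at h
    refine h.congr' ?_
    filter_upwards [hne] with y hy
    rw [shift, add_div, div_self hy]
  have hres : ∀ i, Tendsto (fun y : ℝ => (y * Complex.I) * res (S.lam b f i)
      (S.shift (y * Complex.I) (S.sol (y * Complex.I)) b f)
      (S.shift (y * Complex.I) (S.sol (y * Complex.I)) (!b) f)) atTop (𝓝 (-1)) := by
    intro i
    have hinv2 : Tendsto (fun y : ℝ => ((y * Complex.I : ℂ))⁻¹) atTop (𝓝 0) := by
      rw [tendsto_zero_iff_norm_tendsto_zero]
      simpa only [norm_inv] using hinv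
    -- Dividing the denominator of `res` by `w` leaves `l w⁻² / (a / w) - a' / w`. Both quotients `a
    -- / w` and `a' / w` tend to one, so `w · res` tends to `-1`.
    have h1 : Tendsto (fun y : ℝ => 1 / ((S.lam b f i : ℂ) * (y * Complex.I)⁻¹ * (y * Complex.I)⁻¹ /
        (S.shift (y * Complex.I) (S.sol (y * Complex.I)) b f / (y * Complex.I)) -
        S.shift (y * Complex.I) (S.sol (y * Complex.I)) (!b) f / (y * Complex.I))) atTop
        (𝓝 (1 / ((S.lam b f i : ℂ) * 0 * 0 / 1 - 1))) :=
      tendsto_const_nhds.div ((((tendsto_const_nhds.mul hinv2).mul hinv2).div (hshift b)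
        one_ne_zero).sub (hshift (!b))) (by simp)
    have h2 : (1 : ℂ) / ((S.lam b f i : ℂ) * 0 * 0 / 1 - 1) = -1 := by norm_num
    rw [h2] at h1
    refine h1.congr' ?_
    filter_upwards [eventually_gt_atTop 0] with y hy
    have hy0 : 0 < (y * Complex.I : ℂ).im := by rwa [him]
    have hw0 : (y * Complex.I : ℂ) ≠ 0 := fun h => by rw [h] at hy0; simp at hy0
    have ha := fun b => (isState_sol (S := S) hy0).shift_im_pos (S := S) hy0 b f
    have ha0 : ∀ b, S.shift (y * Complex.I) (S.sol (y * Complex.I)) b f ≠ 0 := fun b h => by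
      have := ha b; rw [h] at this; simp at this
    have hp := ha0 b
    have hd := res_den_ne_zero (S.lam_nonneg b f i) (ha b) (ha (!b))
    rw [res]
    generalize (y * Complex.I : ℂ) = w at *
    generalize S.shift w (S.sol w) b f = p at *
    generalize S.shift w (S.sol w) (!b) f = q at *
    have e : (S.lam b f i : ℂ) * w⁻¹ * w⁻¹ / (p / w) - q / w = ((S.lam b f i : ℂ) / p - q) / w := by
      field_simp
    rw [e, one_div_div, mul_one_div]
  have hfin : Tendsto (fun y : ℝ => (S.c : ℂ) * ∑ i, (y * Complex.I) * res (S.lam b f i)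
      (S.shift (y * Complex.I) (S.sol (y * Complex.I)) b f)
      (S.shift (y * Complex.I) (S.sol (y * Complex.I)) (!b) f)) atTop
      (𝓝 ((S.c : ℂ) * ∑ _i : Fin (S.n b), (-1))) :=
    (tendsto_finsetSum _ fun i _ => hres i).const_mul _
  have e : (S.c : ℂ) * ∑ _i : Fin (S.n b), (-1 : ℂ) = (-(S.c * S.n b : ℝ) : ℂ) := by
    simp
  rw [e] at hfin
  refine hfin.congr' ?_
  filter_upwards [eventually_gt_atTop 0] with y hy
  have hy0 : 0 < (y * Complex.I : ℂ).im := by rwa [him]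
  conv_rhs => rw [← step_sol hy0, step]
  rw [← Finset.mul_sum]
  ring

end ResolventSystem

end

/-! ### The Herglotz representation on the disk -/

section

/-- The Schwarz formula on the unit disk. -/
lemma circleAverage_herglotz_mul_re {f : ℂ → ℂ} (hf : DiffContOnCl ℂ f (Metric.ball 0 1)) {ζ : ℂ}
    (hζ : ζ ∈ Metric.ball (0 : ℂ) 1) :
    Real.circleAverage (fun z => (z + ζ) / (z - ζ) * ((f z).re : ℂ)) 0 1
      = f ζ - Complex.I * (f 0).im := by
  have hζ1 : ‖ζ‖ < 1 := by simpa using hζ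
  have hfc : ContinuousOn f (Metric.sphere 0 1) := hf.2.mono
    (Metric.sphere_subset_closedBall.trans_eq (closure_ball 0 one_ne_zero).symm)
  have hz1 : ∀ z ∈ Metric.sphere (0 : ℂ) 1, z - ζ ≠ 0 := by
    intro z hz h
    rw [sub_eq_zero] at h
    rw [mem_sphere_zero_iff_norm, h] at hz
    exact hζ1.ne hz
  have hz2 : ∀ z ∈ Metric.closedBall (0 : ℂ) 1, 1 - (starRingEnd ℂ) ζ * z ≠ 0 := by
    intro z hz h
    rw [mem_closedBall_zero_iff] at hz
    have : ‖(starRingEnd ℂ) ζ * z‖ = 1 := by rw [← sub_eq_zero.1 h, norm_one]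
    rw [norm_mul, RCLike.norm_conj] at this
    nlinarith [norm_nonneg z, norm_nonneg ζ]
  -- On the circle `z̄ = z⁻¹`, so the conjugate of `k` is the Herglotz kernel times the conjugate of
  -- `f`. As `k` is holomorphic, its mean is `k 0 = f 0`.
  set k : ℂ → ℂ := fun z => (1 + (starRingEnd ℂ) ζ * z) / (1 - (starRingEnd ℂ) ζ * z) * f z
  have hk : DiffContOnCl ℂ k (Metric.ball 0 1) := by
    have h : DiffContOnCl ℂ (fun z => (1 + (starRingEnd ℂ) ζ * z) / (1 - (starRingEnd ℂ) ζ * z))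
        (Metric.ball 0 1) := by
      refine DifferentiableOn.diffContOnCl ?_
      rw [closure_ball 0 one_ne_zero]
      exact DifferentiableOn.div (by fun_prop) (by fun_prop) hz2
    exact h.smul hf
  have hkc : ContinuousOn k (Metric.sphere 0 1) := hk.2.mono
    (Metric.sphere_subset_closedBall.trans_eq (closure_ball 0 one_ne_zero).symm)
  have a1 : Real.circleAverage (fun z => z / (z - ζ) * f z) 0 1 = f ζ := by
    have := DiffContOnCl.circleAverage_smul_div (R := 1) (c := 0) (f := f) (w := ζ)
      (by simpa using hf) (by simpa using hζ1)
    simpa using this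
  have a2 : Real.circleAverage (fun z => (1 / 2 : ℂ) * f z) 0 1 = 1 / 2 * f 0 := by
    rw [← DiffContOnCl.circleAverage (R := 1) (c := 0) (f := f) (by simpa using hf)]
    exact Real.circleAverage_fun_smul (𝕜 := ℂ) (a := (1 / 2 : ℂ))
  have a3 : Real.circleAverage (fun z => (1 / 2 : ℂ) * (starRingEnd ℂ) (k z)) 0 1 =
      1 / 2 * (starRingEnd ℂ) (f 0) := by
    have h1 : k 0 = f 0 := by simp [k]
    rw [← h1, ← DiffContOnCl.circleAverage (R := 1) (c := 0) (f := k) (by simpa using hk)]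
    have h2 := ContinuousLinearMap.circleAverage_comp_comm (c := 0) (R := 1) (f := k)
      (Complex.conjCLE : ℂ →L[ℝ] ℂ) (hkc.circleIntegrable zero_le_one)
    have h3 := Real.circleAverage_fun_smul (𝕜 := ℂ) (a := (1 / 2 : ℂ)) (c := 0) (R := 1)
      (f := fun z => (starRingEnd ℂ) (k z))
    simp only [smul_eq_mul] at h3
    rw [h3]
    congr 1
  have hcont : ContinuousOn (fun z => z / (z - ζ) * f z) (Metric.sphere 0 1) :=
    (continuousOn_id.div (by fun_prop) hz1).mul hfc
  -- Writing `Re f = (f + f̄) / 2` and `(z + ζ) / (z - ζ) = 2z / (z - ζ) - 1` leaves a Cauchy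
  -- integral and two mean values.
  have hsplit : Real.circleAverage (fun z => (z + ζ) / (z - ζ) * ((f z).re : ℂ)) 0 1 =
      Real.circleAverage (fun z => z / (z - ζ) * f z - 1 / 2 * f z +
        1 / 2 * (starRingEnd ℂ) (k z)) 0 1 := by
    refine Real.circleAverage_congr_sphere fun z hz => ?_
    rw [abs_one] at hz
    have hne := hz1 z hz
    have hne2 := hz2 z (Metric.sphere_subset_closedBall hz)
    have hnz : ‖z‖ = 1 := by simpa using hz
    have hz0 : z ≠ 0 := by rintro rfl; simp at hnz
    have hconj : (starRingEnd ℂ) z = z⁻¹ := (Complex.inv_eq_conj hnz).symm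
    have hne3 : 1 - ζ * z⁻¹ ≠ 0 := by
      intro h; apply hne; field_simp at h; simpa using h
    simp only [k, map_mul, map_div₀, map_add, map_sub, map_one, Complex.conj_conj, hconj]
    rw [Complex.re_eq_add_conj]
    have e : (1 + ζ * z⁻¹) / (1 - ζ * z⁻¹) = (z + ζ) / (z - ζ) := by
      field_simp
    rw [e]
    field_simp
    ring
  rw [hsplit, Real.circleAverage_fun_add, Real.circleAverage_fun_sub, a1, a2, a3]
  · have : (f 0) = (f 0).re + (f 0).im * Complex.I := (Complex.re_add_im _).symm
    refine Complex.ext ?_ ?_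
    · simp
    · simp
      ring
  · exact hcont.circleIntegrable zero_le_one
  · exact (continuousOn_const.mul hfc).circleIntegrable zero_le_one
  · exact (hcont.sub (continuousOn_const.mul hfc)).circleIntegrable zero_le_one
  · exact (continuousOn_const.mul (Complex.continuous_conj.comp_continuousOn hkc)).circleIntegrable
      zero_le_one

/-- The parametrization of the unit circle by `[0,1]`. -/
def unitCircle (t : unitInterval) : ℂ := circleMap 0 1 (2 * Real.pi * t)

lemma norm_unitCircle (t : unitInterval) : ‖unitCircle t‖ = 1 := by simp [unitCircle]

lemma continuous_unitCircle : Continuous unitCircle := by unfold unitCircle; fun_prop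

lemma circleAverage_eq_integral_unitInterval (f : ℂ → ℂ) :
    Real.circleAverage f 0 1 = ∫ t, f (unitCircle t) := by
  rw [Real.circleAverage_def]
  have h1 : ∫ t : unitInterval, f (unitCircle t) =
      ∫ t in (0 : ℝ)..1, f (circleMap 0 1 (2 * Real.pi * t)) := by
    rw [intervalIntegral.integral_of_le zero_le_one, ← integral_Icc_eq_integral_Ioc]
    exact integral_subtype_comap (s := Set.Icc (0 : ℝ) 1) measurableSet_Icc
      fun t : ℝ => f (circleMap 0 1 (2 * Real.pi * t))
  rw [h1, intervalIntegral.integral_comp_mul_left (fun θ => f (circleMap 0 1 θ))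
    (by positivity : 2 * Real.pi ≠ 0)]
  simp

lemma unitCircle_sub_ne_zero {ζ : ℂ} (hζ : ‖ζ‖ < 1) (t : unitInterval) : unitCircle t - ζ ≠ 0 := by
  intro h
  have := norm_unitCircle t
  rw [sub_eq_zero.1 h] at this
  exact hζ.ne this

/-- **Herglotz representation** of a function with positive real part on the unit disk. -/
theorem exists_herglotz_measure {F : ℂ → ℂ} (hF : DifferentiableOn ℂ F (Metric.ball 0 1))
    (hre : ∀ ζ ∈ Metric.ball (0 : ℂ) 1, 0 < (F ζ).re) :
    ∃ μ : ProbabilityMeasure unitInterval, ∀ ζ ∈ Metric.ball (0 : ℂ) 1,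
      F ζ = Complex.I * (F 0).im + (F 0).re *
        ∫ t, (unitCircle t + ζ) / (unitCircle t - ζ) ∂(μ : Measure unitInterval) := by
  have hc : 0 < (F 0).re := hre 0 (by simp)
  set r : ℕ → ℝ := fun k => 1 - 1 / ((k : ℝ) + 2)
  have hr0 : ∀ k, 0 < r k := fun k => by
    have : (1 : ℝ) / ((k : ℝ) + 2) < 1 := by
      rw [div_lt_one (by positivity)]; linarith [(Nat.cast_nonneg k : (0 : ℝ) ≤ k)]
    simp only [r]; linarith
  have hr1 : ∀ k, r k < 1 := fun k => by
    have : (0 : ℝ) < 1 / ((k : ℝ) + 2) := by positivity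
    simp only [r]; linarith
  have hmem : ∀ k, ∀ z ∈ Metric.closedBall (0 : ℂ) 1, (r k : ℂ) * z ∈ Metric.ball (0 : ℂ) 1 := by
    intro k z hz
    rw [mem_closedBall_zero_iff] at hz
    rw [mem_ball_zero_iff, norm_mul, Complex.norm_real, Real.norm_of_nonneg (hr0 k).le]
    nlinarith [hr0 k, hr1 k]
  have hG : ∀ k, DiffContOnCl ℂ (fun z => F (r k * z)) (Metric.ball 0 1) := by
    intro k
    refine DifferentiableOn.diffContOnCl ?_
    rw [closure_ball 0 one_ne_zero]
    exact hF.comp (by fun_prop) (hmem k)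
  have hmemc : ∀ k t, (r k : ℂ) * unitCircle t ∈ Metric.ball (0 : ℂ) 1 := fun k t =>
    hmem k _ (by simp [norm_unitCircle])
  have hGc : ∀ k, Continuous fun t => F (r k * unitCircle t) := fun k =>
    hF.continuousOn.comp_continuous (continuous_const.mul continuous_unitCircle) (hmemc k)
  -- On the slightly smaller circle of radius `r k`, the normalized real part is a continuous
  -- probability density, by the Schwarz formula at `ζ = 0`.
  set d : ℕ → unitInterval → ℝ := fun k t => (F (r k * unitCircle t)).re / (F 0).re
  have hd0 : ∀ k t, 0 ≤ d k t := fun k t => (div_pos (hre _ (hmemc k t)) hc).le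
  have hdc : ∀ k, Continuous (d k) := fun k => (Complex.continuous_re.comp (hGc k)).div_const _
  have hSch : ∀ k, ∀ ζ ∈ Metric.ball (0 : ℂ) 1,
      ∫ t, (d k t : ℂ) * ((unitCircle t + ζ) / (unitCircle t - ζ)) =
        (F (r k * ζ) - Complex.I * (F 0).im) / (F 0).re := by
    intro k ζ hζ
    have h := circleAverage_herglotz_mul_re (hG k) hζ
    rw [circleAverage_eq_integral_unitInterval, mul_zero] at h
    rw [← h, ← integral_div]
    congr 1
    funext t
    simp only [d]
    push_cast
    ring
  have hdint : ∀ k, ∫ t, d k t = 1 := by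
    intro k
    have h := hSch k 0 (by simp)
    have e : ∀ t, unitCircle t ≠ 0 := fun t h => by simpa [h] using norm_unitCircle t
    simp only [add_zero, sub_zero, div_self (e _), mul_one, mul_zero] at h
    rw [integral_complex_ofReal] at h
    have h2 : (F 0 - Complex.I * (F 0).im) / (F 0).re = 1 := by
      rw [div_eq_one_iff_eq (by exact_mod_cast hc.ne')]
      apply Complex.ext <;> simp
    rw [h2] at h
    exact_mod_cast h
  have hprob : ∀ k, IsProbabilityMeasure
      ((volume : Measure unitInterval).withDensity fun t => ENNReal.ofReal (d k t)) := by
    intro k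
    refine ⟨?_⟩
    rw [withDensity_apply _ MeasurableSet.univ, setLIntegral_univ,
      ← ofReal_integral_eq_lintegral_ofReal ((hdc k).integrable_of_hasCompactSupport
        (HasCompactSupport.of_compactSpace _)) (ae_of_all _ (hd0 k)), hdint, ENNReal.ofReal_one]
  set μs : ℕ → ProbabilityMeasure unitInterval := fun k => ⟨_, hprob k⟩
  -- Probability measures on the compact interval form a compact space. A limit along an ultrafilter
  -- replaces the extraction of a weakly convergent subsequence.
  set U : Ultrafilter (ProbabilityMeasure unitInterval) := (hyperfilter ℕ).map μs
  refine ⟨U.lim, fun ζ hζ => ?_⟩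
  have hζ1 : ‖ζ‖ < 1 := by simpa using hζ
  have hT : Tendsto μs (hyperfilter ℕ : Filter ℕ) (𝓝 U.lim) := U.le_nhds_lim
  have hkc : Continuous fun t => (unitCircle t + ζ) / (unitCircle t - ζ) :=
    (continuous_unitCircle.add continuous_const).div (continuous_unitCircle.sub continuous_const)
      (unitCircle_sub_ne_zero hζ1)
  have h1 := (ProbabilityMeasure.tendsto_iff_forall_integral_rclike_tendsto ℂ).1 hT
    (BoundedContinuousFunction.mkOfCompact ⟨_, hkc⟩)
  have h2 : ∀ k, ∫ t, (unitCircle t + ζ) / (unitCircle t - ζ) ∂(μs k : Measure unitInterval) =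
      (F (r k * ζ) - Complex.I * (F 0).im) / (F 0).re := by
    intro k
    rw [← hSch k ζ hζ]
    change ∫ t, _ ∂((volume : Measure unitInterval).withDensity
      fun t => ENNReal.ofReal (d k t)) = _
    rw [integral_withDensity_eq_integral_toReal_smul (by have := (hdc k).measurable; fun_prop)
      (ae_of_all _ fun t => ENNReal.ofReal_lt_top)]
    refine integral_congr_ae (ae_of_all _ fun t => ?_)
    simp only [ENNReal.toReal_ofReal (hd0 k t), Complex.real_smul]
  have hrlim : Tendsto r atTop (𝓝 1) := by
    have : Tendsto (fun k : ℕ => (1 : ℝ) / ((k : ℝ) + 2)) atTop (𝓝 0) :=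
      tendsto_const_nhds.div_atTop
        (tendsto_atTop_add_const_right _ _ tendsto_natCast_atTop_atTop)
    simpa [r] using tendsto_const_nhds.sub this
  have h3 : Tendsto (fun k => (F (r k * ζ) - Complex.I * (F 0).im) / (F 0).re) atTop
      (𝓝 ((F ζ - Complex.I * (F 0).im) / (F 0).re)) := by
    have hFζ : ContinuousAt F ζ := (hF.differentiableAt (Metric.isOpen_ball.mem_nhds hζ)).continuousAt
    have hrc : Tendsto (fun k => (r k : ℂ) * ζ) atTop (𝓝 ζ) := by
      simpa using ((Complex.continuous_ofReal.tendsto 1).comp hrlim).mul_const ζ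
    exact ((hFζ.tendsto.comp hrc).sub_const _).div_const _
  have h4 := h3.mono_left (Nat.hyperfilter_le_atTop)
  have h5 : Tendsto (fun k => ∫ t, (unitCircle t + ζ) / (unitCircle t - ζ)
      ∂(μs k : Measure unitInterval)) (hyperfilter ℕ : Filter ℕ)
      (𝓝 (∫ t, (unitCircle t + ζ) / (unitCircle t - ζ) ∂(U.lim : Measure unitInterval))) := h1
  simp_rw [h2] at h5
  have h6 := tendsto_nhds_unique h5 h4
  rw [h6]
  have : ((F 0).re : ℂ) ≠ 0 := by exact_mod_cast hc.ne'
  field_simp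
  ring

end

/-! ### The Stieltjes representation on the upper half-plane -/

section

/-- The Cayley transform of the unit circle onto the line; the value at `1` is irrelevant. -/
def cayleyReal (e : ℂ) : ℝ := (Complex.I * (1 + e) / (1 - e)).re

lemma measurable_cayleyReal : Measurable cayleyReal := by unfold cayleyReal; fun_prop

lemma ofReal_cayleyReal {e : ℂ} (he : ‖e‖ = 1) (he1 : e ≠ 1) :
    (cayleyReal e : ℂ) = Complex.I * (1 + e) / (1 - e) := by
  have h1 : 1 - e ≠ 0 := sub_ne_zero.2 he1.symm
  have he0 : e ≠ 0 := by rintro rfl; simp at he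
  refine Complex.conj_eq_iff_re.1 ?_
  have hconj : (starRingEnd ℂ) e = e⁻¹ := (Complex.inv_eq_conj he).symm
  have h2 : 1 - e⁻¹ ≠ 0 := by
    intro h; apply h1; field_simp at h; linear_combination -h
  have h3 : e - 1 ≠ 0 := sub_ne_zero.2 he1
  simp only [map_div₀, map_mul, map_add, map_sub, map_one, Complex.conj_I, hconj]
  have e1 : (1 + e⁻¹) / (1 - e⁻¹) = -((1 + e) / (1 - e)) := by
    field_simp
    ring
  rw [mul_div_assoc, e1]
  ring

/-- The Herglotz kernel after Cayley transformation of both variables. -/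
lemma herglotz_kernel_cayley {e w : ℂ} (he : ‖e‖ = 1) (hw : 0 < w.im) :
    Complex.I * ((e + (w - Complex.I) / (w + Complex.I)) / (e - (w - Complex.I) / (w + Complex.I))) =
      if e = 1 then w else (1 + cayleyReal e * w) / (cayleyReal e - w) := by
  have hwi : w + Complex.I ≠ 0 := by
    intro h
    have := congr_arg Complex.im h
    simp at this
    linarith
  have hI2 : Complex.I ^ 2 = -1 := Complex.I_sq
  split_ifs with h1
  · subst h1
    have e1 : (1 : ℂ) + (w - Complex.I) / (w + Complex.I) = 2 * w / (w + Complex.I) := by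
      field_simp; ring
    have e2 : (1 : ℂ) - (w - Complex.I) / (w + Complex.I) = 2 * Complex.I / (w + Complex.I) := by
      field_simp; ring
    rw [e1, e2]
    field_simp
  · have h1e : 1 - e ≠ 0 := sub_ne_zero.2 (Ne.symm h1)
    have hx := ofReal_cayleyReal he h1
    have hxw : (cayleyReal e : ℂ) - w ≠ 0 := by
      intro h
      have := congr_arg Complex.im h
      simp at this
      linarith
    generalize (cayleyReal e : ℂ) = x at *
    have hx' : x * (1 - e) = Complex.I * (1 + e) := by rw [hx]; field_simp
    have e1 : e + (w - Complex.I) / (w + Complex.I) =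
        (1 - e) * (-Complex.I) * (1 + x * w) / (w + Complex.I) := by
      field_simp
      linear_combination (Complex.I * w) * hx' + (w * (1 + e)) * hI2
    have e2 : e - (w - Complex.I) / (w + Complex.I) =
        (1 - e) * (x - w) / (w + Complex.I) := by
      field_simp
      linear_combination - hx'
    rw [e1, e2]
    field_simp
    linear_combination (-(1 + x * w)) * hI2

/-- **Nevanlinna representation** of the functions that are Stieltjes transforms: a holomorphic
`m` with positive imaginary part and `i y m(i y) → -κ` is the Stieltjes transform of a measure of
mass `κ`. -/
theorem exists_stieltjes_measure {m : ℂ → ℂ} (hd : DifferentiableOn ℂ m {w | 0 < w.im})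
    (him : ∀ w : ℂ, 0 < w.im → 0 < (m w).im) {κ : ℝ}
    (hlim : Tendsto (fun y : ℝ => (y * Complex.I) * m (y * Complex.I)) atTop (𝓝 (-(κ : ℂ)))) :
    ∃ ρ : Measure ℝ, ρ Set.univ = ENNReal.ofReal κ ∧
      ∀ w : ℂ, 0 < w.im → m w = ∫ x : ℝ, 1 / ((x : ℂ) - w) ∂ρ := by
  set toHalf : ℂ → ℂ := fun ζ => Complex.I * (1 + ζ) / (1 - ζ) with htoHalf
  have hne1 : ∀ ζ ∈ Metric.ball (0 : ℂ) 1, 1 - ζ ≠ 0 := by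
    intro ζ hζ h
    rw [mem_ball_zero_iff, ← sub_eq_zero.1 h] at hζ
    simp at hζ
  have hmaps : ∀ ζ ∈ Metric.ball (0 : ℂ) 1, 0 < (toHalf ζ).im := by
    intro ζ hζ
    have hn := hne1 ζ hζ
    rw [mem_ball_zero_iff, ← sq_lt_one_iff₀ (norm_nonneg _), Complex.sq_norm,
      Complex.normSq_apply] at hζ
    have e : (toHalf ζ).im = (1 - (ζ.re * ζ.re + ζ.im * ζ.im)) / Complex.normSq (1 - ζ) := by
      rw [htoHalf]
      simp only [Complex.div_im]
      simp
      ring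
    rw [e]
    have := Complex.normSq_pos.2 hn
    apply div_pos _ this
    linarith
  have hinv : ∀ w : ℂ, 0 < w.im → (w - Complex.I) / (w + Complex.I) ∈ Metric.ball (0 : ℂ) 1 ∧
      toHalf ((w - Complex.I) / (w + Complex.I)) = w := by
    intro w hw
    have hwi : w + Complex.I ≠ 0 := by
      intro h
      have := congr_arg Complex.im h
      simp at this
      linarith
    constructor
    · rw [mem_ball_zero_iff, norm_div, div_lt_one (norm_pos_iff.2 hwi),
        ← sq_lt_sq₀ (norm_nonneg _) (norm_nonneg _), Complex.sq_norm, Complex.sq_norm,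
        Complex.normSq_apply, Complex.normSq_apply]
      simp
      nlinarith
    · have e1 : (1 : ℂ) + (w - Complex.I) / (w + Complex.I) = 2 * w / (w + Complex.I) := by
        field_simp; ring
      have e2 : (1 : ℂ) - (w - Complex.I) / (w + Complex.I) = 2 * Complex.I / (w + Complex.I) := by
        field_simp; ring
      rw [htoHalf]
      simp only
      rw [e1, e2]
      field_simp
  -- Multiplication by `-i` turns positive imaginary part into positive real part, and the Cayley
  -- map moves the problem to the disk.
  have hFd : DifferentiableOn ℂ (fun ζ => -Complex.I * m (toHalf ζ)) (Metric.ball 0 1) := by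
    refine DifferentiableOn.const_mul (hd.comp ?_ hmaps) _
    exact DifferentiableOn.div (by fun_prop) (by fun_prop) hne1
  obtain ⟨μ, hμ⟩ := exists_herglotz_measure hFd fun ζ hζ => by
    simpa using him _ (hmaps ζ hζ)
  have hc : 0 < (m Complex.I).im := him _ (by simp)
  have hF0 : toHalf 0 = Complex.I := by simp [htoHalf]
  set c := (m Complex.I).im
  set x : unitInterval → ℝ := fun t => cayleyReal (unitCircle t)
  have hxm : Measurable x := measurable_cayleyReal.comp continuous_unitCircle.measurable
  have hE : MeasurableSet {t | unitCircle t = 1} :=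
    (isClosed_eq continuous_unitCircle continuous_const).measurableSet
  have hrep : ∀ w : ℂ, 0 < w.im → Integrable (fun t => if unitCircle t = 1 then w else
      (1 + x t * w) / (x t - w)) (μ : Measure unitInterval) ∧ m w = (m Complex.I).re + c *
      ∫ t, (if unitCircle t = 1 then w else (1 + x t * w) / (x t - w)) ∂(μ : Measure unitInterval) := by
    intro w hw
    obtain ⟨h1, h2⟩ := hinv w hw
    have h3 := hμ _ h1
    have hζ : ‖(w - Complex.I) / (w + Complex.I)‖ < 1 := by simpa using h1
    have hfun : (fun t => if unitCircle t = 1 then w else (1 + x t * w) / (x t - w)) = fun t =>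
        Complex.I * ((unitCircle t + (w - Complex.I) / (w + Complex.I)) /
          (unitCircle t - (w - Complex.I) / (w + Complex.I))) := by
      funext t
      exact (herglotz_kernel_cayley (norm_unitCircle t) hw).symm
    constructor
    · rw [hfun]
      refine Continuous.integrable_of_hasCompactSupport ?_ (HasCompactSupport.of_compactSpace _)
      exact continuous_const.mul ((continuous_unitCircle.add continuous_const).div
        (continuous_unitCircle.sub continuous_const) (unitCircle_sub_ne_zero hζ))
    · rw [hfun, integral_const_mul]
      simp only [h2, hF0] at h3
      have h4 : m w = Complex.I * (-Complex.I * m w) := by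
        rw [← mul_assoc]; simp
      rw [h4, h3]
      simp only [c]
      simp
      linear_combination (-((m Complex.I).re : ℂ)) * Complex.I_sq
  -- the total mass, by monotone convergence along `i n`
  set q : ℕ → unitInterval → ℝ := fun k t => if unitCircle t = 1 then ((k : ℝ) + 1) ^ 2 else
    (1 + x t ^ 2) * ((k : ℝ) + 1) ^ 2 / (x t ^ 2 + ((k : ℝ) + 1) ^ 2)
  set Q : unitInterval → ENNReal := fun t => if unitCircle t = 1 then ⊤ else
    ENNReal.ofReal (1 + x t ^ 2)
  have hq0 : ∀ k t, 0 ≤ q k t := fun k t => by simp only [q]; split_ifs <;> positivity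
  have hqm : ∀ k, Measurable (q k) := fun k => Measurable.ite hE measurable_const (by fun_prop)
  have hqim : ∀ (k : ℕ) t, q k t = ((k : ℝ) + 1) * (if unitCircle t = 1 then
      (((k : ℝ) + 1 : ℝ) * Complex.I : ℂ) else (1 + x t * (((k : ℝ) + 1 : ℝ) * Complex.I)) /
        (x t - ((k : ℝ) + 1 : ℝ) * Complex.I)).im := by
    intro k t
    simp only [q]
    have hk : (0 : ℝ) < (k : ℝ) + 1 := by positivity
    generalize (k : ℝ) + 1 = y at hk
    split_ifs
    · simp; ring
    · rw [Complex.div_im]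
      simp [Complex.normSq_apply]
      have : x t ^ 2 + y ^ 2 ≠ 0 := by positivity
      have : x t * x t + y * y ≠ 0 := by rw [← sq, ← sq]; positivity
      field_simp
      ring
  have hqint : ∀ k : ℕ, Integrable (q k) (μ : Measure unitInterval) ∧
      ∫ t, q k t ∂(μ : Measure unitInterval) = ((k : ℝ) + 1) *
        (m (((k : ℝ) + 1 : ℝ) * Complex.I)).im / c := by
    intro k
    have hk : (0 : ℝ) < (k : ℝ) + 1 := by positivity
    obtain ⟨h1, h2⟩ := hrep (((k : ℝ) + 1 : ℝ) * Complex.I) (by simpa using hk)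
    have e : q k = fun t => ((k : ℝ) + 1) * (if unitCircle t = 1 then
      (((k : ℝ) + 1 : ℝ) * Complex.I : ℂ) else (1 + x t * (((k : ℝ) + 1 : ℝ) * Complex.I)) /
        (x t - ((k : ℝ) + 1 : ℝ) * Complex.I)).im := funext (hqim k)
    rw [e]
    refine ⟨h1.im.const_mul _, ?_⟩
    rw [integral_const_mul, h2, Complex.add_im, Complex.im_ofReal_mul, Complex.ofReal_im, zero_add]
    have e2 := integral_im h1
    simp only [RCLike.im_eq_complex_im] at e2
    rw [e2]
    field_simp
  have hmono : ∀ t, Monotone fun k => ENNReal.ofReal (q k t) := by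
    intro t j k hjk
    refine ENNReal.ofReal_le_ofReal ?_
    simp only [q]
    have hjk' : (j : ℝ) + 1 ≤ (k : ℝ) + 1 := by gcongr
    have hj : (0 : ℝ) < (j : ℝ) + 1 := by positivity
    generalize (j : ℝ) + 1 = y at *
    generalize (k : ℝ) + 1 = y' at *
    split_ifs
    · gcongr
    · have hy2 : y ^ 2 ≤ y' ^ 2 := by gcongr
      have hy' := hj.trans_le hjk'
      rw [div_le_div_iff₀ (by positivity) (by positivity)]
      have : 0 ≤ (1 + x t ^ 2) * x t ^ 2 * (y' ^ 2 - y ^ 2) :=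
        mul_nonneg (by positivity) (sub_nonneg.2 hy2)
      nlinarith
  have hnat : Tendsto (fun k : ℕ => (k : ℝ) + 1) atTop atTop :=
    tendsto_atTop_add_const_right _ _ tendsto_natCast_atTop_atTop
  have hqlim : ∀ t, Tendsto (fun k => ENNReal.ofReal (q k t)) atTop (𝓝 (Q t)) := by
    intro t
    simp only [q, Q]
    split_ifs
    · exact ENNReal.tendsto_ofReal_atTop.comp ((tendsto_pow_atTop two_ne_zero).comp hnat)
    · refine ENNReal.tendsto_ofReal ?_
      have h1 : Tendsto (fun k : ℕ => (1 + x t ^ 2) / (x t ^ 2 / ((k : ℝ) + 1) ^ 2 + 1)) atTop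
          (𝓝 ((1 + x t ^ 2) / (0 + 1))) :=
        tendsto_const_nhds.div ((tendsto_const_nhds.div_atTop
          ((tendsto_pow_atTop two_ne_zero).comp hnat)).add_const 1) (by norm_num)
      rw [zero_add, div_one] at h1
      refine h1.congr fun k => ?_
      have : (0 : ℝ) < (k : ℝ) + 1 := by positivity
      field_simp
  have hlimim : Tendsto (fun k : ℕ => ((k : ℝ) + 1) * (m (((k : ℝ) + 1 : ℝ) * Complex.I)).im / c)
      atTop (𝓝 (κ / c)) := by
    have h1 := (Complex.continuous_re.tendsto _).comp (hlim.comp hnat)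
    have h2 := h1.neg.div_const c
    simp only [Complex.neg_re, Complex.ofReal_re, neg_neg] at h2
    refine h2.congr fun k => ?_
    simp
  have hQint : ∫⁻ t, Q t ∂(μ : Measure unitInterval) = ENNReal.ofReal (κ / c) := by
    refine tendsto_nhds_unique (lintegral_tendsto_of_tendsto_of_monotone
      (fun k => ((hqm k).ennreal_ofReal).aemeasurable) (ae_of_all _ hmono) (ae_of_all _ hqlim)) ?_
    refine (ENNReal.tendsto_ofReal hlimim).congr fun k => ?_
    rw [← ofReal_integral_eq_lintegral_ofReal (hqint k).1 (ae_of_all _ (hq0 k)), (hqint k).2]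
  have hQm : Measurable Q := Measurable.ite hE measurable_const (by fun_prop)
  -- The limit `Q` has finite integral, so the point at infinity carries no mass and the
  -- representation has no term linear in `w`.
  have hae : ∀ᵐ t ∂(μ : Measure unitInterval), unitCircle t ≠ 1 := by
    filter_upwards [ae_lt_top hQm (by rw [hQint]; exact ENNReal.ofReal_ne_top)] with t ht h
    simp [Q, h] at ht
  have hQ' : ∫⁻ t, ENNReal.ofReal (1 + x t ^ 2) ∂(μ : Measure unitInterval) =
      ENNReal.ofReal (κ / c) := by
    rw [← hQint]
    refine lintegral_congr_ae ?_
    filter_upwards [hae] with t ht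
    simp [Q, ht]
  have hx2 : Integrable (fun t => 1 + x t ^ 2) (μ : Measure unitInterval) := by
    refine ⟨Measurable.aestronglyMeasurable (by fun_prop), ?_⟩
    rw [hasFiniteIntegral_iff_ofReal (ae_of_all _ fun t => by positivity), hQ']
    exact ENNReal.ofReal_lt_top
  have hx1 : Integrable x (μ : Measure unitInterval) := by
    refine hx2.mono hxm.aestronglyMeasurable (ae_of_all _ fun t => ?_)
    rw [Real.norm_eq_abs, Real.norm_of_nonneg (by positivity)]
    nlinarith [sq_abs (x t), sq_nonneg (|x t| - 1), abs_nonneg (x t)]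
  set δ : unitInterval → ENNReal := fun t => ENNReal.ofReal (c * (1 + x t ^ 2))
  have hδm : Measurable δ := by simp only [δ]; fun_prop
  set ρ : Measure ℝ := ((μ : Measure unitInterval).withDensity δ).map x
  have hρ : ρ Set.univ = ENNReal.ofReal κ := by
    rw [Measure.map_apply hxm MeasurableSet.univ, Set.preimage_univ,
      withDensity_apply _ MeasurableSet.univ, setLIntegral_univ]
    simp only [δ, ENNReal.ofReal_mul hc.le]
    rw [lintegral_const_mul _ (by fun_prop), hQ', ← ENNReal.ofReal_mul hc.le]
    congr 1
    field_simp
  have hfinρ : IsFiniteMeasure ρ := ⟨by rw [hρ]; exact ENNReal.ofReal_lt_top⟩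
  -- Since `(1 + xw) / (x - w) = (1 + x²) / (x - w) - x`, the kernel becomes a Stieltjes kernel with
  -- weight `1 + x²`, up to a constant; the finite second moment makes both parts integrable.
  set C₀ : ℂ := (m Complex.I).re - c * ∫ t, (x t : ℂ) ∂(μ : Measure unitInterval)
  have hmain : ∀ w : ℂ, 0 < w.im → m w = C₀ + ∫ x : ℝ, 1 / ((x : ℂ) - w) ∂ρ := by
    intro w hw
    have hne : ∀ t, (x t : ℂ) - w ≠ 0 := by
      intro t h
      have := congr_arg Complex.im h
      simp at this
      linarith
    have h1 : ∫ x : ℝ, 1 / ((x : ℂ) - w) ∂ρ = ∫ t, ((c * (1 + x t ^ 2) : ℝ) : ℂ) *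
        (1 / ((x t : ℂ) - w)) ∂(μ : Measure unitInterval) := by
      rw [integral_map hxm.aemeasurable (Measurable.aestronglyMeasurable (by fun_prop)),
        integral_withDensity_eq_integral_toReal_smul hδm
          (ae_of_all _ fun t => ENNReal.ofReal_lt_top)]
      refine integral_congr_ae (ae_of_all _ fun t => ?_)
      simp only [δ, Complex.real_smul]
      rw [ENNReal.toReal_ofReal (by positivity)]
    obtain ⟨hi, hr⟩ := hrep w hw
    have hxC : Integrable (fun t => (x t : ℂ)) (μ : Measure unitInterval) := hx1.ofReal
    rw [hr, h1, ← integral_const_mul]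
    simp only [C₀]
    rw [sub_add_eq_add_sub, eq_sub_iff_add_eq, add_assoc, ← integral_const_mul, ← integral_add
      (hi.const_mul _) (hxC.const_mul _)]
    congr 1
    refine integral_congr_ae ?_
    filter_upwards [hae] with t ht
    have := hne t
    simp only [ht, if_false]
    push_cast
    field_simp
    ring
  have hatTop : ∀ᶠ y : ℝ in atTop, 0 < y := eventually_gt_atTop 0
  have hinvlim : Tendsto (fun y : ℝ => ((y * Complex.I : ℂ))⁻¹) atTop (𝓝 0) := by
    rw [tendsto_zero_iff_norm_tendsto_zero]
    simp only [norm_inv, norm_mul, Complex.norm_real, Complex.norm_I, mul_one]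
    exact tendsto_inv_atTop_zero.comp (tendsto_atTop_mono (fun y => le_abs_self y) tendsto_id)
  have hm0 : Tendsto (fun y : ℝ => m (y * Complex.I)) atTop (𝓝 0) := by
    have := hinvlim.mul hlim
    rw [zero_mul] at this
    refine this.congr' ?_
    filter_upwards [hatTop] with y hy
    have : (y * Complex.I : ℂ) ≠ 0 := by simp [hy.ne']
    field_simp
  have hS0 : Tendsto (fun y : ℝ => ∫ x : ℝ, 1 / ((x : ℂ) - y * Complex.I) ∂ρ) atTop (𝓝 0) := by
    have : Tendsto (fun y : ℝ => y⁻¹ * ρ.real Set.univ) atTop (𝓝 0) := by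
      simpa using tendsto_inv_atTop_zero.mul_const (ρ.real Set.univ)
    refine squeeze_zero_norm' ?_ this
    filter_upwards [hatTop] with y hy
    refine norm_integral_le_of_norm_le_const (ae_of_all _ fun x => ?_)
    rw [one_div, norm_inv]
    refine inv_anti₀ hy ?_
    have := Complex.abs_im_le_norm ((x : ℂ) - y * Complex.I)
    simpa [abs_of_pos hy] using this
  -- Both `m(iy)` and the Stieltjes integral vanish at infinity, so the constant does too.
  have hC : C₀ = 0 := by
    have h1 := hm0.sub hS0
    rw [sub_zero] at h1
    refine tendsto_nhds_unique (tendsto_const_nhds.congr' ?_) h1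
    filter_upwards [hatTop] with y hy
    rw [hmain (y * Complex.I) (by simpa using hy)]
    ring
  exact ⟨ρ, hρ, fun w hw => by rw [hmain w hw, hC, zero_add]⟩

end

/-! ### Solutions as Stieltjes transforms on the half-line -/

section

lemma norm_one_div_ofReal_sub_le {w : ℂ} (hw : 0 < w.im) (x : ℝ) :
    ‖1 / ((x : ℂ) - w)‖ ≤ 1 / w.im := by
  rw [norm_div, norm_one]
  refine one_div_le_one_div_of_le hw ?_
  have := Complex.abs_im_le_norm ((x : ℂ) - w)
  simpa [abs_of_pos hw] using this

lemma integrable_one_div_ofReal_sub {ν : Measure ℝ} [IsFiniteMeasure ν] {w : ℂ} (hw : 0 < w.im) :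
    Integrable (fun x : ℝ => 1 / ((x : ℂ) - w)) ν :=
  Integrable.of_bound (Measurable.aestronglyMeasurable (by fun_prop)) (1 / w.im)
    (ae_of_all _ (norm_one_div_ofReal_sub_le hw))

lemma ofReal_sub_ne_zero {w : ℂ} (hw : 0 < w.im) (x : ℝ) : (x : ℂ) - w ≠ 0 := by
  intro h
  have := congr_arg Complex.im h
  simp at this
  linarith

/-- Stieltjes transforms of probability measures on the half-line map the upper half-plane to
itself, and stay there after multiplication by the variable, weakly. -/
lemma im_stieltjes_nonneg {ν : Measure ℝ} [IsProbabilityMeasure ν] (hν : ν (Set.Iio 0) = 0) {z : ℂ}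
    (hz : 0 < z.im) : 0 ≤ (∫ x : ℝ, 1 / ((x : ℂ) - z) ∂ν).im ∧
      0 ≤ (z * ∫ x : ℝ, 1 / ((x : ℂ) - z) ∂ν).im := by
  have hi := integrable_one_div_ofReal_sub (ν := ν) hz
  have hae : ∀ᵐ x ∂ν, 0 ≤ x := by
    rw [ae_iff]
    simpa [Set.Iio, not_le] using hν
  constructor
  · have e : (∫ x : ℝ, 1 / ((x : ℂ) - z) ∂ν).im = ∫ x : ℝ, (1 / ((x : ℂ) - z)).im ∂ν :=
      (integral_im hi).symm
    rw [e]
    refine integral_nonneg fun x => ?_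
    rw [one_div, Complex.inv_im]
    have := Complex.normSq_nonneg ((x : ℂ) - z)
    simp
    positivity
  · rw [← integral_const_mul]
    have e : (∫ x : ℝ, z * (1 / ((x : ℂ) - z)) ∂ν).im = ∫ x : ℝ, (z * (1 / ((x : ℂ) - z))).im ∂ν :=
      (integral_im (hi.const_mul z)).symm
    rw [e]
    refine integral_nonneg_of_ae ?_
    filter_upwards [hae] with x hx
    rw [mul_one_div, Complex.div_im]
    have h0 := Complex.normSq_nonneg ((x : ℂ) - z)
    have : z.im * ((x : ℂ) - z).re / Complex.normSq ((x : ℂ) - z) -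
        z.re * ((x : ℂ) - z).im / Complex.normSq ((x : ℂ) - z) =
        x * z.im / Complex.normSq ((x : ℂ) - z) := by
      simp
      ring
    rw [this]
    change (0 : ℝ) ≤ _
    positivity

namespace ResolventSystem

variable {S : ResolventSystem}

/-- Let `ρ` be the measure on the line that represents the solution in the variable `w`. The
symmetry `w ↦ -w̄` provides a second representation with kernel `-1 / (x + w)`, and the average of
the two kernels is `w / (x² - w²)`. Pushing the normalized `ρ` forward by `x ↦ x²` gives a
probability measure on the half-line and a Stieltjes transform in `z = w²`. -/
theorem exists_probability_sol (b : Bool) (f : unitInterval) :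
    ∃ ν : Measure ℝ, IsProbabilityMeasure ν ∧ ν (Set.Iio 0) = 0 ∧
      ∀ w : ℂ, 0 < w.im → 0 < w.re →
        S.sol w b f = S.c * S.n b * (w * ∫ x : ℝ, 1 / ((x : ℂ) - w ^ 2) ∂ν) := by
  obtain ⟨ρ, hρ, hrep⟩ := exists_stieltjes_measure (κ := S.c * S.n b) (differentiableOn_sol (S := S) b f)
    (fun w hw => sol_im_pos hw b f) (by simpa using tendsto_mul_sol b f)
  have hκ : 0 < S.c * S.n b := mul_pos S.c_pos (by exact_mod_cast S.n_pos b)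
  have hκE : ENNReal.ofReal (S.c * S.n b) ≠ 0 := by simpa using hκ
  have hfin : IsFiniteMeasure ρ := ⟨by rw [hρ]; exact ENNReal.ofReal_lt_top⟩
  have hsq : Measurable fun x : ℝ => x ^ 2 := by fun_prop
  refine ⟨((ENNReal.ofReal (S.c * S.n b))⁻¹ • ρ).map (fun x => x ^ 2), ⟨?_⟩, ?_, fun w hw hre => ?_⟩
  · rw [Measure.map_apply hsq MeasurableSet.univ, Set.preimage_univ, Measure.smul_apply, hρ,
      smul_eq_mul, ENNReal.inv_mul_cancel hκE ENNReal.ofReal_ne_top]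
  · rw [Measure.map_apply hsq measurableSet_Iio]
    have : (fun x : ℝ => x ^ 2) ⁻¹' Set.Iio 0 = ∅ := by
      ext x
      simpa using sq_nonneg x
    rw [this, measure_empty]
  · have hw2 : 0 < (w ^ 2).im := by
      rw [sq, Complex.mul_im]; positivity
    have hw' : 0 < (-(starRingEnd ℂ) w).im := by simpa using hw
    have h1 := hrep w hw
    have h2 := hrep _ hw'
    rw [sol_neg_conj hw, neg_eq_iff_eq_neg] at h2
    have h3 : S.sol w b f = -∫ x : ℝ, 1 / ((x : ℂ) + w) ∂ρ := by
      rw [← Complex.conj_conj (S.sol w b f), h2, map_neg, ← integral_conj]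
      simp
    have hi := integrable_one_div_ofReal_sub (ν := ρ) hw
    have hi' : Integrable (fun x : ℝ => 1 / ((x : ℂ) + w)) ρ := by
      refine Integrable.of_bound (Measurable.aestronglyMeasurable (by fun_prop)) (1 / w.im)
        (ae_of_all _ fun x => ?_)
      have := norm_one_div_ofReal_sub_le hw (-x)
      have e : ((-x : ℝ) : ℂ) - w = -((x : ℂ) + w) := by push_cast; ring
      rwa [e, one_div_neg_eq_neg_one_div, norm_neg] at this
    have h4 : S.sol w b f = ∫ x : ℝ, (1 / 2 : ℂ) * (1 / ((x : ℂ) - w) - 1 / ((x : ℂ) + w)) ∂ρ := by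
      rw [integral_const_mul, integral_sub hi hi', ← h1, sub_eq_add_neg, ← h3]
      ring
    rw [integral_map hsq.aemeasurable (Measurable.aestronglyMeasurable (by fun_prop)),
      integral_smul_measure, ENNReal.toReal_inv, ENNReal.toReal_ofReal hκ.le, Complex.real_smul, h4]
    have hne : ((S.c * S.n b : ℝ) : ℂ) ≠ 0 := by exact_mod_cast hκ.ne'
    push_cast at hne ⊢
    rw [mul_left_comm w, ← mul_assoc ((S.c : ℂ) * S.n b), mul_inv_cancel₀ hne, one_mul,
      ← integral_const_mul]
    refine integral_congr_ae (ae_of_all _ fun x => ?_)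
    have n1 := ofReal_sub_ne_zero hw x
    have n2 : (x : ℂ) + w ≠ 0 := by
      have := ofReal_sub_ne_zero hw (-x)
      intro h
      apply this
      push_cast
      linear_combination -h
    have n3 : (x : ℂ) ^ 2 - w ^ 2 ≠ 0 := by
      rw [sq_sub_sq]; exact mul_ne_zero n2 n1
    simp only
    rw [eq_comm, mul_one_div, div_eq_iff n3]
    field_simp
    ring

end ResolventSystem

end

/-! ### The matrix resolvents -/

section

section Matrix

variable {ι : Type*} [Fintype ι] [DecidableEq ι]

lemma res_den_eq {z u v p q : ℂ} (hu : u ≠ 0) (huv : z = u * v) (l : ℝ) :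
    -z * q + p⁻¹ * l = u * (l / (u * p) - v * q) := by
  subst huv
  rw [mul_sub, mul_div_assoc', mul_div_mul_left _ _ hu]
  ring

/-- The resolvent matrices are invertible and their traces are sums of `res`. The factorization
`z = u v` may be chosen freely. -/
lemma resolvent_trace {B : Matrix ι ι ℂ} (hB : B.PosSemidef) {z u v p q : ℂ} (hu : u ≠ 0)
    (huv : z = u * v) (hp : 0 < (u * p).im) (hq : 0 < (v * q).im) :
    IsUnit ((-z * q) • (1 : Matrix ι ι ℂ) + p⁻¹ • B) ∧
      u * ((-z * q) • (1 : Matrix ι ι ℂ) + p⁻¹ • B)⁻¹.trace =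
        ∑ i, res (hB.isHermitian.eigenvalues i) (u * p) (v * q) := by
  have h : ∀ i, -z * q + p⁻¹ * (hB.isHermitian.eigenvalues i) ≠ 0 := by
    intro i
    rw [res_den_eq hu huv]
    exact mul_ne_zero hu (res_den_ne_zero (hB.eigenvalues_nonneg i) hp hq)
  refine ⟨isUnit_smul_one_add_smul hB.isHermitian h, ?_⟩
  rw [trace_inv_smul_one_add_smul hB.isHermitian h, Finset.mul_sum]
  refine Finset.sum_congr rfl fun i _ => ?_
  rw [res_den_eq hu huv, res, mul_one_div, div_mul_cancel_left₀ hu, one_div]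

/-- The sum is the trace of a resolvent, here with `z = u = v = 1`, so its continuity follows from
that of the matrix. -/
lemma continuous_sum_res {X : Type*} [TopologicalSpace X] {B : X → Matrix ι ι ℂ}
    (hB : ∀ x, (B x).PosSemidef) (hBc : Continuous B) {a a' : X → ℂ} (ha : Continuous a)
    (ha' : Continuous a') (hpos : ∀ x, 0 < (a x).im) (hpos' : ∀ x, 0 < (a' x).im) :
    Continuous fun x => ∑ i, res ((hB x).isHermitian.eigenvalues i) (a x) (a' x) := by
  have h := fun x => resolvent_trace (hB x) (z := 1) (u := 1) (v := 1) (p := a x) (q := a' x)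
    one_ne_zero (by simp) (by simpa using hpos x) (by simpa using hpos' x)
  simp only [one_mul] at h
  simp_rw [← fun x => (h x).2]
  have hne : ∀ x, a x ≠ 0 := fun x hx => by
    have := hpos x
    rw [hx] at this; simp at this
  exact continuous_trace_inv (((continuous_const.mul ha').smul continuous_const).add
    ((ha.inv₀ hne).smul hBc)) fun x => (h x).1

lemma exists_eigenvalues_le {B : unitInterval → Matrix ι ι ℂ} (hB : ∀ x, (B x).PosSemidef)
    (hBc : Continuous B) : ∃ C : ℝ, ∀ x i, (hB x).isHermitian.eigenvalues i ≤ C := by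
  obtain ⟨C, hC⟩ := isCompact_univ.exists_bound_of_continuousOn
    (Complex.continuous_re.comp hBc.matrix_trace).continuousOn
  exact ⟨C, fun x i => (eigenvalues_le_trace (hB x) i).trans
    ((le_abs_self _).trans (hC x (Set.mem_univ x)))⟩

end Matrix

section System

variable {N T : ℕ} (L : ℕ) (A : ℤ → Matrix (Fin N) (Fin T) ℂ) {γ : ℤ → ℂ}

lemma posSemidef_gram (f : unitInterval) :
    (matFourier L A f * (matFourier L A f).conjTranspose).PosSemidef :=
  Matrix.posSemidef_self_mul_conjTranspose _

lemma posSemidef_gram' (f : unitInterval) :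
    ((matFourier L A f).conjTranspose * matFourier L A f).PosSemidef :=
  Matrix.posSemidef_conjTranspose_mul_self _

lemma continuous_gram : Continuous fun f : unitInterval =>
    matFourier L A f * (matFourier L A f).conjTranspose := by
  have h : Continuous fun f : unitInterval => matFourier L A f :=
    (continuous_matFourier L A).comp continuous_subtype_val
  exact h.matrix_mul h.matrix_conjTranspose

lemma continuous_gram' : Continuous fun f : unitInterval =>
    (matFourier L A f).conjTranspose * matFourier L A f := by
  have h : Continuous fun f : unitInterval => matFourier L A f :=
    (continuous_matFourier L A).comp continuous_subtype_val
  exact h.matrix_conjTranspose.matrix_mul h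

lemma covFourier_re_nonneg (hγ : IsCovarianceFunction γ) (hγs : Summable fun k => ‖γ k‖)
    (x : ℝ) : 0 ≤ (covFourier γ x).re :=
  (Complex.le_def.1 (covFourier_nonneg hγ hγs x)).1

lemma ofReal_covFourier_re (hγ : IsCovarianceFunction γ) (hγs : Summable fun k => ‖γ k‖)
    (x : ℝ) : ((covFourier γ x).re : ℂ) = covFourier γ x :=
  Complex.ext (by simp) (by simpa using (Complex.le_def.1 (covFourier_nonneg hγ hγs x)).2)

lemma norm_covFourier_le (hγs : Summable fun k => ‖γ k‖) (x : ℝ) : ‖covFourier γ x‖ ≤ ∑' k, ‖γ k‖ := by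
  refine (norm_tsum_le_tsum_norm ?_).trans (le_of_eq ?_)
  · simpa [norm_exp_fourier] using hγs
  · simp [norm_exp_fourier]

end System

end

/-! ### The matrix equations as a resolvent system -/

section

section System

variable {N T : ℕ}

/-- The resolvent system satisfied by `(wφ, wφ̃)` in the variable `w = √z`. -/
def mimoSystem (hN : 0 < N) (hT : 0 < T) (L : ℕ) (A : ℤ → Matrix (Fin N) (Fin T) ℂ) {s : ℝ}
    (hs : 0 ≤ s) {γ : ℤ → ℂ} (hγ : IsCovarianceFunction γ) (hγs : Summable fun k => ‖γ k‖) :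
    ResolventSystem where
  n b := match b with
    | true => N
    | false => T
  n_pos b := match b with
    | true => hN
    | false => hT
  c := (T : ℝ)⁻¹
  c_pos := by positivity
  lam b := match b with
    | true => fun f => (posSemidef_gram L A f).isHermitian.eigenvalues
    | false => fun f => (posSemidef_gram' L A f).isHermitian.eigenvalues
  lam_nonneg b := match b with
    | true => fun f => (posSemidef_gram L A f).eigenvalues_nonneg
    | false => fun f => (posSemidef_gram' L A f).eigenvalues_nonneg
  B := max (exists_eigenvalues_le (posSemidef_gram L A) (continuous_gram L A)).choose
    (exists_eigenvalues_le (posSemidef_gram' L A) (continuous_gram' L A)).choose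
  lam_le b := match b with
    | true => fun f i => ((exists_eigenvalues_le (posSemidef_gram L A)
        (continuous_gram L A)).choose_spec f i).trans (le_max_left _ _)
    | false => fun f i => ((exists_eigenvalues_le (posSemidef_gram' L A)
        (continuous_gram' L A)).choose_spec f i).trans (le_max_right _ _)
  ker b := match b with
    | true => fun f u => s * (covFourier γ (u - f)).re
    | false => fun f u => s * (covFourier γ (f - u)).re
  ker_nonneg b f u := match b with
    | true => mul_nonneg hs (covFourier_re_nonneg hγ hγs _)
    | false => mul_nonneg hs (covFourier_re_nonneg hγ hγs _)
  K := s * ∑' k, ‖γ k‖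
  ker_le b f u := match b with
    | true => mul_le_mul_of_nonneg_left
        ((Complex.re_le_norm _).trans (norm_covFourier_le hγs _)) hs
    | false => mul_le_mul_of_nonneg_left
        ((Complex.re_le_norm _).trans (norm_covFourier_le hγs _)) hs
  ker_cont b := match b with
    | true => by
        have := continuous_covFourier hγs
        simp only [Function.uncurry_def]
        fun_prop
    | false => by
        have := continuous_covFourier hγs
        simp only [Function.uncurry_def]
        fun_prop
  trace_cont b := match b with
    | true => fun _ _ ha ha' h h' =>
        continuous_sum_res (posSemidef_gram L A) (continuous_gram L A) ha ha' h h'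
    | false => fun _ _ ha ha' h h' =>
        continuous_sum_res (posSemidef_gram' L A) (continuous_gram' L A) ha ha' h h'

/-- The pair of unknowns after the substitution `m = w φ`. -/
def scaledPair (w : ℂ) (φ φt : unitInterval → ℂ) (b : Bool) (f : unitInterval) : ℂ :=
  w * match b with
    | true => φ f
    | false => φt f

end System

section Solution

variable {N T : ℕ} {hN : 0 < N} {hT : 0 < T} {L : ℕ} {A : ℤ → Matrix (Fin N) (Fin T) ℂ}
  {s : ℝ} {hs : 0 ≤ s} {γ : ℤ → ℂ} {hγ : IsCovarianceFunction γ}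
  {hγs : Summable fun k => ‖γ k‖} {z w : ℂ} {φ φt : unitInterval → ℂ}

lemma shift_scaledPair_true (f : unitInterval) :
    (mimoSystem hN hT L A hs hγ hγs).shift w (scaledPair w φ φt) true f = w * den s γ φ f := by
  simp only [ResolventSystem.shift, mimoSystem, scaledPair, den, convNeg, mul_add, mul_one]
  congr 1
  rw [← integral_const_mul, ← integral_const_mul]
  refine integral_congr_ae (ae_of_all _ fun u => ?_)
  simp only [Complex.ofReal_mul, ofReal_covFourier_re hγ hγs]
  ring

lemma shift_scaledPair_false (f : unitInterval) :
    (mimoSystem hN hT L A hs hγ hγs).shift w (scaledPair w φ φt) false f =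
      w * denTilde s γ φt f := by
  simp only [ResolventSystem.shift, mimoSystem, scaledPair, denTilde, conv, mul_add, mul_one]
  congr 1
  rw [← integral_const_mul, ← integral_const_mul]
  refine integral_congr_ae (ae_of_all _ fun u => ?_)
  simp only [Complex.ofReal_mul, ofReal_covFourier_re hγ hγs]
  ring

/-- If `φ` and `w² φ` have nonnegative imaginary parts, then so has `w φ`. -/
lemma im_mul_nonneg_of_sq {w x : ℂ} (hre : 0 < w.re) (h : 0 ≤ x.im) (h2 : 0 ≤ (w ^ 2 * x).im) :
    0 ≤ (w * x).im := by
  -- This is the imaginary part of `(w² + |w|²) x = 2 (Re w) w x`.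
  have e : (w ^ 2 * x).im + Complex.normSq w * x.im = 2 * w.re * (w * x).im := by
    simp [sq, Complex.normSq_apply]
    ring
  have h3 : 0 ≤ 2 * w.re * (w * x).im := by
    rw [← e]
    have := Complex.normSq_nonneg w
    positivity
  exact nonneg_of_mul_nonneg_right h3 (by positivity)

/-- Passing to the square root merges the two sign conditions on each function into one. The
converse fails pointwise, so admissibility of the constructed solution needs a separate argument. -/
lemma IsAdmissible.isState (h : IsAdmissible (w ^ 2) φ φt) (hre : 0 < w.re) :
    ResolventSystem.IsState (scaledPair w φ φt) where
  integrable b := by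
    cases b
    · exact h.integrable_tilde.const_mul w
    · exact h.integrable.const_mul w
  im_nonneg b f := by
    cases b
    · exact im_mul_nonneg_of_sq hre (h.im_nonneg_tilde f) (h.im_mul_nonneg_tilde f)
    · exact im_mul_nonneg_of_sq hre (h.im_nonneg f) (h.im_mul_nonneg f)

lemma exists_sqrt_of_im_pos (hz : 0 < z.im) : ∃ w : ℂ, w ^ 2 = z ∧ 0 < w.im ∧ 0 < w.re := by
  obtain ⟨w, hw⟩ := IsAlgClosed.exists_pow_nat_eq z two_pos
  have him : 2 * (w.re * w.im) = z.im := by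
    rw [← hw, sq, Complex.mul_im]; ring
  have hpos : 0 < w.re * w.im := by linarith
  rcases pos_and_pos_or_neg_and_neg_of_mul_pos hpos with ⟨h1, h2⟩ | ⟨h1, h2⟩
  · exact ⟨w, hw, h2, h1⟩
  · exact ⟨-w, by rw [neg_sq, hw], by simpa using h2, by simpa using h1⟩

lemma im_mul_den_pos (hs : 0 ≤ s) (hγ : IsCovarianceFunction γ) (hγs : Summable fun k => ‖γ k‖)
    (h : IsAdmissible (w ^ 2) φ φt) (hw : 0 < w.im) (hre : 0 < w.re)
    (f : unitInterval) : 0 < (w * den s γ φ f).im := by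
  -- The denominator does not involve the matrices, so a dummy system with `N = T = 1` and `A = 0`
  -- serves.
  rw [← shift_scaledPair_true (hN := one_pos) (hT := one_pos) (L := 0) (A := 0) (hs := hs)
    (hγ := hγ) (hγs := hγs) (φt := φt)]
  exact (h.isState hre).shift_im_pos hw true f

lemma im_mul_denTilde_pos (hs : 0 ≤ s) (hγ : IsCovarianceFunction γ)
    (hγs : Summable fun k => ‖γ k‖) (h : IsAdmissible (w ^ 2) φ φt) (hw : 0 < w.im)
    (hre : 0 < w.re) (f : unitInterval) : 0 < (w * denTilde s γ φt f).im := by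
  rw [← shift_scaledPair_false (hN := one_pos) (hT := one_pos) (L := 0) (A := 0) (hs := hs)
    (hγ := hγ) (hγs := hγs) (φ := φ)]
  exact (h.isState hre).shift_im_pos hw false f

lemma step_scaledPair_true (h : IsAdmissible (w ^ 2) φ φt) (hw : 0 < w.im) (hre : 0 < w.re)
    (f : unitInterval) :
    (mimoSystem hN hT L A hs hγ hγs).step w (scaledPair w φ φt) true f =
      w * ((matS L A s γ (w ^ 2) φ φt f).trace / T) := by
  have hw0 : w ≠ 0 := by rintro rfl; simp at hw
  have h1 := (resolvent_trace (posSemidef_gram L A f) hw0 (sq w)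
    (im_mul_den_pos hs hγ hγs h hw hre f) (im_mul_denTilde_pos hs hγ hγs h hw hre f)).2
  rw [matS, preS, mul_div_assoc', h1, ResolventSystem.step, Bool.not_true, shift_scaledPair_true,
    shift_scaledPair_false, div_eq_inv_mul]
  congr 1
  simp [mimoSystem]

lemma step_scaledPair_false (h : IsAdmissible (w ^ 2) φ φt) (hw : 0 < w.im) (hre : 0 < w.re)
    (f : unitInterval) :
    (mimoSystem hN hT L A hs hγ hγs).step w (scaledPair w φ φt) false f =
      w * ((matSTilde L A s γ (w ^ 2) φ φt f).trace / T) := by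
  have hw0 : w ≠ 0 := by rintro rfl; simp at hw
  have h1 := (resolvent_trace (posSemidef_gram' L A f) hw0 (sq w)
    (im_mul_denTilde_pos hs hγ hγs h hw hre f) (im_mul_den_pos hs hγ hγs h hw hre f)).2
  rw [matSTilde, preSTilde, mul_div_assoc', h1, ResolventSystem.step, Bool.not_false,
    shift_scaledPair_true, shift_scaledPair_false, div_eq_inv_mul]
  congr 1
  simp [mimoSystem]

/-- The matrix equations are the fixed point equation of the resolvent system. -/
lemma isSolution_iff (hw : 0 < w.im) (hre : 0 < w.re) :
    IsSolution L A s γ (w ^ 2) φ φt ↔ IsAdmissible (w ^ 2) φ φt ∧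
      (mimoSystem hN hT L A hs hγ hγs).step w (scaledPair w φ φt) = scaledPair w φ φt := by
  have hw0 : w ≠ 0 := by rintro rfl; simp at hw
  constructor
  · intro h
    refine ⟨h.toIsAdmissible, ?_⟩
    funext b f
    cases b
    · rw [step_scaledPair_false h.toIsAdmissible hw hre, ← h.eq_tilde f, scaledPair]
    · rw [step_scaledPair_true h.toIsAdmissible hw hre, ← h.eq f, scaledPair]
  · rintro ⟨h, e⟩
    refine ⟨h, fun f => ?_, fun f => ?_⟩
    · have := congr_fun (congr_fun e true) f
      rw [step_scaledPair_true h hw hre, scaledPair] at this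
      exact (mul_left_cancel₀ hw0 this).symm
    · have := congr_fun (congr_fun e false) f
      rw [step_scaledPair_false h hw hre, scaledPair] at this
      exact (mul_left_cancel₀ hw0 this).symm

lemma IsSolution.scaledPair_eq_sol (h : IsSolution L A s γ (w ^ 2) φ φt) (hw : 0 < w.im)
    (hre : 0 < w.re) : scaledPair w φ φt = (mimoSystem hN hT L A hs hγ hγs).sol w :=
  (h.toIsAdmissible.isState hre).eq_of_step_eq (ResolventSystem.isState_sol hw) hw
    ((isSolution_iff hw hre).1 h).2 (ResolventSystem.step_sol hw)

end Solution

end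

/-! ### Strict positivity -/

section

variable {N T : ℕ} {hN : 0 < N} {hT : 0 < T} {L : ℕ} {A : ℤ → Matrix (Fin N) (Fin T) ℂ}
  {s : ℝ} {hs : 0 ≤ s} {γ : ℤ → ℂ} {hγ : IsCovarianceFunction γ}
  {hγs : Summable fun k => ‖γ k‖} {z w : ℂ} {φ φt : unitInterval → ℂ}

lemma stieltjes_im_pos {ν : Measure ℝ} [IsProbabilityMeasure ν] (hz : 0 < z.im) :
    0 < (∫ x : ℝ, 1 / ((x : ℂ) - z) ∂ν).im := by
  have hi := integrable_one_div_ofReal_sub (ν := ν) hz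
  have e : (∫ x : ℝ, 1 / ((x : ℂ) - z) ∂ν).im = ∫ x : ℝ, (1 / ((x : ℂ) - z)).im ∂ν :=
    (integral_im hi).symm
  have hpos : ∀ x : ℝ, 0 < (1 / ((x : ℂ) - z)).im := by
    intro x
    rw [one_div, Complex.inv_im]
    have := Complex.normSq_pos.2 (ofReal_sub_ne_zero hz x)
    simp
    positivity
  rw [e, integral_pos_iff_support_of_nonneg (fun x => (hpos x).le) hi.im]
  have : (Function.support fun x : ℝ => (1 / ((x : ℂ) - z)).im) = Set.univ := by
    ext x
    simpa using (hpos x).ne'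
  rw [this]
  simp

/-- The solution of the resolvent system solves the matrix equations. -/
lemma isSolution_of_scaledPair_eq_sol (hw : 0 < w.im) (hre : 0 < w.re)
    (h : scaledPair w φ φt = (mimoSystem hN hT L A hs hγ hγs).sol w) :
    IsSolution L A s γ (w ^ 2) φ φt := by
  have hw0 : w ≠ 0 := by rintro rfl; simp at hw
  have hz : 0 < (w ^ 2).im := by rw [sq, Complex.mul_im]; positivity
  have hst := ResolventSystem.isState_sol (S := mimoSystem hN hT L A hs hγ hγs) hw
  rw [← h] at hst
  have hinv : ∀ b, Integrable fun f => w⁻¹ * scaledPair w φ φt b f := fun b =>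
    (hst.integrable b).const_mul _
  simp only [scaledPair, inv_mul_cancel_left₀ hw0] at hinv
  -- Both sign conditions come from the representing measure on the half-line; the fixed point
  -- equation itself only provides `Im (wφ) ≥ 0`.
  have him : ∀ b f, 0 ≤ (w⁻¹ * scaledPair w φ φt b f).im ∧
      0 ≤ (w ^ 2 * (w⁻¹ * scaledPair w φ φt b f)).im := by
    intro b f
    obtain ⟨ν, hν, hν0, hrep⟩ :=
      ResolventSystem.exists_probability_sol (S := mimoSystem hN hT L A hs hγ hγs) b f
    rw [h, hrep w hw hre, mul_left_comm, inv_mul_cancel_left₀ hw0, mul_left_comm (w ^ 2)]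
    have hc := (mimoSystem hN hT L A hs hγ hγs).c_pos
    obtain ⟨h1, h2⟩ := im_stieltjes_nonneg hν0 hz
    rw [← Complex.ofReal_natCast, ← Complex.ofReal_mul, Complex.im_ofReal_mul,
      Complex.im_ofReal_mul]
    exact ⟨by positivity, by positivity⟩
  simp only [scaledPair, inv_mul_cancel_left₀ hw0] at him
  refine (isSolution_iff (hN := hN) (hT := hT) (hs := hs) (hγ := hγ) (hγs := hγs) hw hre).2
    ⟨⟨hinv true, hinv false, fun f => (him true f).1, fun f => (him false f).1,
      fun f => (him true f).2, fun f => (him false f).2⟩, ?_⟩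
  rw [h]
  exact ResolventSystem.step_sol hw

lemma IsSolution.eq_sol (hN : 0 < N) (hT : 0 < T) (hs : 0 ≤ s) (hγ : IsCovarianceFunction γ)
    (hγs : Summable fun k => ‖γ k‖) (h : IsSolution L A s γ (w ^ 2) φ φt) (hw : 0 < w.im)
    (hre : 0 < w.re) :
    φ = (fun f => w⁻¹ * (mimoSystem hN hT L A hs hγ hγs).sol w true f) ∧
      φt = fun f => w⁻¹ * (mimoSystem hN hT L A hs hγ hγs).sol w false f := by
  have hw0 : w ≠ 0 := by rintro rfl; simp at hw
  rw [← h.scaledPair_eq_sol hw hre]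
  simp only [scaledPair, inv_mul_cancel_left₀ hw0]
  exact ⟨trivial, trivial⟩

lemma integral_covFourier_sub' (hs : Summable fun k => ‖γ k‖) (f : ℝ) :
    ∫ u : unitInterval, covFourier γ (u - f) = γ 0 := by
  -- Reversing the sequence reflects its Fourier series and keeps the value at `0`.
  have h := integral_covFourier_sub (γ := fun k => γ (-k)) ((Equiv.neg ℤ).summable_iff.2 hs) f
  rw [neg_zero] at h
  rw [← h]
  refine integral_congr_ae (ae_of_all _ fun u => ?_)
  simp only [covFourier]
  rw [← (Equiv.neg ℤ).tsum_eq]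
  refine tsum_congr fun k => ?_
  simp only [Equiv.neg_apply]
  congr 2
  push_cast
  ring

/-- A nonnegative kernel of total mass one turns strictly positive imaginary parts into strictly
positive ones. -/
lemma im_integral_kernel_pos {k : unitInterval → ℂ} (hk : Continuous k)
    (hk0 : ∀ u, 0 ≤ k u) (hk1 : ∫ u, k u = 1) {ψ : unitInterval → ℂ} (hψ : Continuous ψ)
    (hpos : ∀ u, 0 < (ψ u).im) : 0 < (∫ u, k u * ψ u).im := by
  -- By compactness `Im ψ` attains a positive minimum, and averaging with total mass one cannot fall
  -- below it.
  obtain ⟨u₀, -, hu₀⟩ := isCompact_univ.exists_isMinOn Set.univ_nonempty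
    (Complex.continuous_im.comp hψ).continuousOn
  have hi : ∀ {g : unitInterval → ℂ}, Continuous g → Integrable g := fun hg =>
    hg.integrable_of_hasCompactSupport (HasCompactSupport.of_compactSpace _)
  have e : (∫ u, k u * ψ u).im = ∫ u, (k u * ψ u).im := (integral_im (hi (hk.mul hψ))).symm
  have e1 : (∫ u, k u).re = ∫ u, (k u).re := (integral_re (hi hk)).symm
  rw [hk1, Complex.one_re] at e1
  rw [e]
  calc 0 < (ψ u₀).im := hpos u₀
    _ = ∫ u, (k u).re * (ψ u₀).im := by rw [integral_mul_const, ← e1, one_mul]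
    _ ≤ ∫ u, (k u * ψ u).im := by
        refine integral_mono ((hi hk).re.mul_const _) (hi (hk.mul hψ)).im fun u => ?_
        have h1 := Complex.le_def.1 (hk0 u)
        simp only [Complex.zero_re, Complex.zero_im] at h1
        simp only [Complex.mul_im, ← h1.2, zero_mul, add_zero]
        exact mul_le_mul_of_nonneg_left (hu₀ (Set.mem_univ u)) h1.1

lemma im_integral_kernel_nonneg {k : unitInterval → ℂ} (hk : Continuous k)
    (hk0 : ∀ u, 0 ≤ k u) {ψ : unitInterval → ℂ} (hψ : Continuous ψ)
    (hpos : ∀ u, 0 ≤ (ψ u).im) : 0 ≤ (∫ u, k u * ψ u).im := by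
  have e : (∫ u, k u * ψ u).im = ∫ u, (k u * ψ u).im :=
    (integral_im ((hk.mul hψ).integrable_of_hasCompactSupport
      (HasCompactSupport.of_compactSpace _))).symm
  rw [e]
  refine integral_nonneg fun u => ?_
  have h1 := Complex.le_def.1 (hk0 u)
  simp only [Complex.zero_re, Complex.zero_im] at h1
  simp only [Complex.mul_im, ← h1.2, zero_mul, add_zero]
  exact mul_nonneg h1.1 (hpos u)

section Kernel

variable {k : unitInterval → ℂ} {ψ : unitInterval → ℂ}

lemma im_mul_one_add_pos (hs : 0 ≤ s) (hk : Continuous k) (hk0 : ∀ u, 0 ≤ k u) (hz : 0 < z.im)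
    (hψ : Continuous ψ) (hpos : ∀ u, 0 ≤ (z * ψ u).im) :
    0 < (z * (1 + (s : ℂ) * ∫ u, k u * ψ u)).im := by
  have h := im_integral_kernel_nonneg (ψ := fun u => z * ψ u) hk hk0
    (continuous_const.mul hψ) hpos
  have e : ∫ u, k u * (z * ψ u) = z * ∫ u, k u * ψ u := by
    rw [← integral_const_mul]
    refine integral_congr_ae (ae_of_all _ fun u => ?_)
    simp only
    ring
  rw [e] at h
  rw [mul_add, mul_one, mul_left_comm, Complex.add_im, Complex.im_ofReal_mul]
  positivity

lemma im_one_add_pos (hs : 0 < s) (hk : Continuous k) (hk0 : ∀ u, 0 ≤ k u)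
    (hk1 : ∫ u, k u = 1) (hψ : Continuous ψ) (hpos : ∀ u, 0 < (ψ u).im) :
    0 < (1 * (1 + (s : ℂ) * ∫ u, k u * ψ u)).im := by
  have h := im_integral_kernel_pos hk hk0 hk1 hψ hpos
  rw [one_mul, Complex.add_im, Complex.one_im, zero_add, Complex.im_ofReal_mul]
  positivity

end Kernel

lemma res_im_pos {l : ℝ} {a a' : ℂ} (hl : 0 ≤ l) (ha : 0 < a.im) (ha' : 0 < a'.im) :
    0 < (res l a a').im := by
  have : 0 < ‖res l a a'‖ := norm_pos_iff.2 (one_div_ne_zero (res_den_ne_zero hl ha ha'))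
  rw [res_im]
  positivity

/-- Uses the trace formula with the factorization `z = z · 1` instead of `w · w`: then `z · tr` is a
sum of values of `res` at `z p` and `q`. The requirement `Im q > 0` is where a positive `σ²` is
needed. -/
lemma im_mul_trace_div_pos {n T : ℕ} (hn : 0 < n) (hT : 0 < T) {B : Matrix (Fin n) (Fin n) ℂ}
    (hB : B.PosSemidef) {z p q : ℂ} (hz : 0 < z.im) (hp : 0 < (z * p).im)
    (hq : 0 < (1 * q).im) :
    0 < (z * (((-z * q) • (1 : Matrix (Fin n) (Fin n) ℂ) + p⁻¹ • B)⁻¹.trace / (T : ℂ))).im := by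
  have hz0 : z ≠ 0 := by rintro rfl; simp at hz
  have h := (resolvent_trace hB hz0 (mul_one z).symm hp hq).2
  rw [mul_div_assoc', h, ← Complex.ofReal_natCast, Complex.div_ofReal_im, Complex.im_sum]
  have : Nonempty (Fin n) := ⟨⟨0, hn⟩⟩
  exact div_pos (Finset.sum_pos (fun i _ => res_im_pos (hB.eigenvalues_nonneg i) hp hq)
    Finset.univ_nonempty) (by exact_mod_cast hT)

end

end ErgodicMIMO

end

/-! ### Assembly of the four claims -/

theorem theorem2 {N T : ℕ} (hN : 0 < N) (hT : 0 < T) (L : ℕ)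
    (A : ℤ → Matrix (Fin N) (Fin T) ℂ) (hA : ∀ k : ℤ, (L : ℤ) < |k| → A k = 0)
    (amp : ℤ → ℝ) (hamp_nonneg : ∀ ℓ, 0 ≤ amp ℓ) (hamp : ∀ ℓ : ℤ, (L : ℤ) < |ℓ| → amp ℓ = 0)
    (γ : ℤ → ℂ) (hγ : IsCovarianceFunction γ) (hγ_zero : γ 0 = 1)
    (hγ_summable : Summable fun k => ‖γ k‖) :
    -- the inverses in the system make sense for all admissible pairs
    (∀ z : ℂ, 0 < z.im → ∀ φ φt : unitInterval → ℂ, IsAdmissible z φ φt →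
      ∀ f : unitInterval,
        den (power L amp) γ φ f ≠ 0 ∧ denTilde (power L amp) γ φt f ≠ 0 ∧
        IsUnit (preS L A (power L amp) γ z φ φt f) ∧
        IsUnit (preSTilde L A (power L amp) γ z φ φt f)) ∧
    -- existence and uniqueness, for each fixed `z`
    (∀ z : ℂ, 0 < z.im → ∃! p : (unitInterval → ℂ) × (unitInterval → ℂ),
      IsSolution L A (power L amp) γ z p.1 p.2) ∧
    -- continuity and strict positivity
    (∀ z : ℂ, 0 < z.im → ∀ φ φt : unitInterval → ℂ,
      IsSolution L A (power L amp) γ z φ φt →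
        Continuous φ ∧ Continuous φt ∧
        (∀ f, 0 < (φ f).im ∧ 0 < (φt f).im) ∧
        (0 < power L amp → ∀ f, 0 < (z * φ f).im ∧ 0 < (z * φt f).im)) ∧
    -- as functions of `z`, the solutions are Stieltjes transforms
    (∃ φ φt : unitInterval → ℂ → ℂ,
      (∀ z : ℂ, 0 < z.im →
        IsSolution L A (power L amp) γ z (fun f => φ f z) (fun f => φt f z)) ∧
      ∀ f : unitInterval,
        IsStieltjesTransform (fun z => (T : ℂ) / (N : ℂ) * φ f z) ∧
        IsStieltjesTransform (φt f)) := by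
  have hs : 0 ≤ power L amp := Finset.sum_nonneg fun _ _ => sq_nonneg _
  have hc := continuous_covFourier hγ_summable
  have hTc : (T : ℂ) ≠ 0 := by exact_mod_cast hT.ne'
  have hNc : (N : ℂ) ≠ 0 := by exact_mod_cast hN.ne'
  generalize power L amp = s at hs
  have hex : ∀ w : ℂ, 0 < w.im → 0 < w.re → ∀ φ φt : unitInterval → ℂ,
      (∀ f, w * φ f = (mimoSystem hN hT L A hs hγ hγ_summable).sol w true f) →
      (∀ f, w * φt f = (mimoSystem hN hT L A hs hγ hγ_summable).sol w false f) →
      IsSolution L A s γ (w ^ 2) φ φt := by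
    intro w hw hre φ φt h1 h2
    refine isSolution_of_scaledPair_eq_sol (hN := hN) (hT := hT) (hs := hs) (hγ := hγ)
      (hγs := hγ_summable) hw hre ?_
    funext b f
    cases b
    · exact h2 f
    · exact h1 f
  refine ⟨fun z hz φ φt h f => ?_, fun z hz => ?_, fun z hz φ φt h => ?_, ?_⟩
  · obtain ⟨w, rfl, hw, hre⟩ := exists_sqrt_of_im_pos hz
    have hw0 : w ≠ 0 := by rintro rfl; simp at hw
    have h1 := im_mul_den_pos hs hγ hγ_summable h hw hre f
    have h2 := im_mul_denTilde_pos hs hγ hγ_summable h hw hre f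
    exact ⟨fun h0 => by simp [h0] at h1, fun h0 => by simp [h0] at h2,
      (resolvent_trace (posSemidef_gram L A f) hw0 (sq w) h1 h2).1,
      (resolvent_trace (posSemidef_gram' L A f) hw0 (sq w) h2 h1).1⟩
  · obtain ⟨w, rfl, hw, hre⟩ := exists_sqrt_of_im_pos hz
    have hw0 : w ≠ 0 := by rintro rfl; simp at hw
    refine ⟨(fun f => w⁻¹ * (mimoSystem hN hT L A hs hγ hγ_summable).sol w true f,
      fun f => w⁻¹ * (mimoSystem hN hT L A hs hγ hγ_summable).sol w false f),
      hex w hw hre _ _ (fun f => mul_inv_cancel_left₀ hw0 _)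
        (fun f => mul_inv_cancel_left₀ hw0 _), ?_⟩
    rintro ⟨φ, φt⟩ h
    obtain ⟨h1, h2⟩ := h.eq_sol hN hT hs hγ hγ_summable hw hre
    exact Prod.ext h1 h2
  · obtain ⟨w, rfl, hw, hre⟩ := exists_sqrt_of_im_pos hz
    have hw0 : w ≠ 0 := by rintro rfl; simp at hw
    obtain ⟨h1, h2⟩ := h.eq_sol hN hT hs hγ hγ_summable hw hre
    have hsolc : ∀ b, Continuous ((mimoSystem hN hT L A hs hγ hγ_summable).sol w b) := by
      intro b
      rw [← ResolventSystem.step_sol hw]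
      exact (ResolventSystem.isState_sol hw).continuous_step hw b
    have hφ : Continuous φ := by rw [h1]; exact continuous_const.mul (hsolc true)
    have hφt : Continuous φt := by rw [h2]; exact continuous_const.mul (hsolc false)
    -- Dividing the representation by `w` leaves a positive multiple of a Stieltjes transform at
    -- `z`, whose imaginary part is strictly positive.
    have hpos : ∀ b f, 0 < (w⁻¹ * (mimoSystem hN hT L A hs hγ hγ_summable).sol w b f).im := by
      intro b f
      obtain ⟨ν, hν, hν0, hrep⟩ := ResolventSystem.exists_probability_sol
        (S := mimoSystem hN hT L A hs hγ hγ_summable) b f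
      rw [hrep w hw hre, mul_left_comm, inv_mul_cancel_left₀ hw0, ← Complex.ofReal_natCast,
        ← Complex.ofReal_mul, Complex.im_ofReal_mul]
      exact mul_pos (mul_pos (ResolventSystem.c_pos _)
        (by exact_mod_cast ResolventSystem.n_pos _ b)) (stieltjes_im_pos hz)
    have hφpos : ∀ f, 0 < (φ f).im := fun f => by rw [h1]; exact hpos true f
    have hφtpos : ∀ f, 0 < (φt f).im := fun f => by rw [h2]; exact hpos false f
    refine ⟨hφ, hφt, fun f => ⟨hφpos f, hφtpos f⟩, fun hs0 f => ?_⟩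
    have hk : Continuous fun u : unitInterval => covFourier γ (f - u) := by fun_prop
    have hk' : Continuous fun u : unitInterval => covFourier γ (u - f) := by fun_prop
    have hk0 := fun u : unitInterval => covFourier_nonneg hγ hγ_summable (f - u)
    have hk0' := fun u : unitInterval => covFourier_nonneg hγ hγ_summable (u - f)
    constructor
    · rw [h.eq f]
      exact im_mul_trace_div_pos hN hT (posSemidef_gram L A f) hz
        (im_mul_one_add_pos hs hk' hk0' hz hφ h.im_mul_nonneg)
        (im_one_add_pos hs0 hk hk0 ((integral_covFourier_sub hγ_summable f).trans hγ_zero) hφt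
          hφtpos)
    · rw [h.eq_tilde f]
      exact im_mul_trace_div_pos hT hT (posSemidef_gram' L A f) hz
        (im_mul_one_add_pos hs hk hk0 hz hφt h.im_mul_nonneg_tilde)
        (im_one_add_pos hs0 hk' hk0' ((integral_covFourier_sub' hγ_summable f).trans hγ_zero) hφ
          hφpos)
  · choose ν hν hν0 hrep using fun b f => ResolventSystem.exists_probability_sol
      (S := mimoSystem hN hT L A hs hγ hγ_summable) b f
    -- The representing measures define the extension to all `z`. The factors are the total weights
    -- `c · n`, namely `N / T` and `T / T = 1`; in the upper half-plane the functions agree with the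
    -- fixed point at `w = √z`.
    refine ⟨fun f z => (N : ℂ) / (T : ℂ) * ∫ x : ℝ, 1 / ((x : ℂ) - z) ∂(ν true f),
      fun f z => ∫ x : ℝ, 1 / ((x : ℂ) - z) ∂(ν false f), fun z hz => ?_, fun f => ⟨?_, ?_⟩⟩
    · obtain ⟨w, rfl, hw, hre⟩ := exists_sqrt_of_im_pos hz
      refine hex w hw hre _ _ (fun f => ?_) fun f => ?_
      · rw [hrep true f w hw hre]
        simp only [mimoSystem, Complex.ofReal_inv, Complex.ofReal_natCast]
        ring
      · rw [hrep false f w hw hre]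
        simp only [mimoSystem, Complex.ofReal_inv, Complex.ofReal_natCast]
        rw [inv_mul_cancel₀ hTc, one_mul]
    · refine ⟨ν true f, hν true f, hν0 true f, fun z _ => ?_⟩
      beta_reduce
      rw [← mul_assoc, div_mul_div_cancel₀ hNc, div_self hTc, one_mul]
    · exact ⟨ν false f, hν false f, hν0 false f, fun z _ => rfl⟩
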